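/- Graphs are finite and undirected, loops and parallel edges being allowed, and surfaces are orientable. The genus $\gamma(G)$ of a graph $G$ is the least total genus of an embedding of $G$ given by a rotation system, that is, by a cyclic ordering of the edge-ends at each vertex; here the total genus $k$ of a rotation system is determined by Euler's formula $|V|-|E|+|F| = 2c-2k$, where $c$ is the number of components and $|F|$ is the number of faces traced by the rotation system, an isolated vertex contributing one face. (By the Edmonds--Heffter correspondence this is the least $k$ such that $G$ embeds in the orientable surface $S_k$ with $k$ handles.) Let $H_3$ be the graph formed by attaching a pendant vertex, called a free node, to each of the three $2$-valent vertices of $K_{2,3}$. **Theorem (Milgram).** Let $G$ be a graph, let $n \ge 0$, and let $T_n = \{t_0,\dots,t_{n-1}\}$ be a set of $n$ pairwise disjoint triples of distinct $2$-valent vertices of $G$, such that the three vertices of each triple lie in the same connected component of $G$ (this is automatic if $G$ is connected). Let $H(G,T_n)$ be the scaffolded graph formed by taking $n$ disjoint copies of $H_3$ and identifying, for each $i$, the three free nodes of the $i$-th copy one-to-one with the three vertices of $t_i$. Let $S(G,T_n)$ be the family of the $3^n$ graphs obtained from $G$ by adding, for each $i$, one new edge between two vertices of the triple $t_i$, and let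 $$\gamma_{T_n}(G) = \min_{X\in S(G,T_n)} \gamma(X).$$ Then $$\gamma(H(G,T_n)) = \gamma_{T_n}(G) + n.$$ -/

import Mathlib

/-! Finite undirected graphs, possibly with loops and parallel edges, are Mathlib's `Graph α β`
with finite vertex and edge sets. -/

namespace Graph

/-- The valence of `v`: the number of edge-ends at `v`, so that a loop counts twice. -/
noncomputable def valence {α β : Type*} (G : Graph α β) (v : α) : ℕ :=
  (G.incidenceSet v).ncard + (G.loopSet v).ncard

/-- There is a walk from `x` to `y` in `G`. -/
def Reachable {α β : Type*} (G : Graph α β) (x y : α) : Prop :=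
  Relation.ReflTransGen G.Adj x y

/-- The number of connected components of `G`. -/
noncomputable def numComponents {α β : Type*} (G : Graph α β) : ℕ :=
  {C : Set α | ∃ x ∈ G.vertexSet, C = {y | G.Reachable x y}}.ncard

/-- A rotation system of `G`: each edge `e` gets two ends `(e, false)` and `(e, true)`, placed at
the two vertices joined by `e`, and the edge-ends at each vertex get a cyclic ordering.
The orderings at all the vertices together are one permutation `rot` of the edge-ends whose orbits
are the sets of edge-ends at a common vertex. -/
structure RotationSystem {α β : Type*} (G : Graph α β) where
  /-- the vertex at which an edge-end sits -/
  base : G.edgeSet × Bool → α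
  isLink_base : ∀ e : G.edgeSet, G.IsLink e (base (e, false)) (base (e, true))
  /-- the successor of an edge-end in the cyclic ordering at its vertex -/
  rot : Equiv.Perm (G.edgeSet × Bool)
  sameCycle_rot_iff : ∀ d d', rot.SameCycle d d' ↔ base d = base d'

/-- The permutation exchanging the two ends of every edge. -/
def flipEnds {β : Type*} (E : Set β) : Equiv.Perm (E × Bool) :=
  Equiv.prodCongr (Equiv.refl E) Equiv.boolNot

/-- The face-tracing permutation: cross the edge, then turn to the next edge-end. -/
def RotationSystem.faceTrace {α β : Type*} {G : Graph α β} (R : G.RotationSystem) :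
    Equiv.Perm (G.edgeSet × Bool) :=
  R.rot * flipEnds G.edgeSet

/-- The number of faces, summed over the cellular embeddings of the components: the orbits of the
face-tracing permutation, and one face (the rest of a sphere) for each isolated vertex. -/
noncomputable def RotationSystem.numFaces {α β : Type*} {G : Graph α β}
    (R : G.RotationSystem) : ℕ :=
  Nat.card (Quotient (Equiv.Perm.SameCycle.setoid R.faceTrace)) +
    {v ∈ G.vertexSet | ∀ e, ¬ G.Inc e v}.ncard

/-- The rotation system `R` describes an orientable embedding of total genus `k`: Euler's formula
`|V| - |E| + |F| = 2 c - 2 k`, where `c` is the number of components (the sum over the components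
of the formulas `|V| - |E| + |F| = 2 - 2 k` of their cellular embeddings). -/
def RotationSystem.HasGenus {α β : Type*} {G : Graph α β} (R : G.RotationSystem) (k : ℕ) : Prop :=
  G.vertexSet.ncard + R.numFaces + 2 * k = G.edgeSet.ncard + 2 * G.numComponents

/-- The minimum (orientable) genus of a finite graph. -/
noncomputable def genus {α β : Type*} (G : Graph α β) : ℕ :=
  sInf {k : ℕ | ∃ R : G.RotationSystem, R.HasGenus k}

/-- Add to `G` one new edge for each `c : γ`, with ends `p c`. The ends of the new edges are
added to the vertex set if they are not in it. -/
def addEdges {α β γ : Type*} (G : Graph α β) (p : γ → Sym2 α) : Graph α (β ⊕ γ) where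
  vertexSet := G.vertexSet ∪ {x | ∃ c, x ∈ p c}
  IsLink e x y := Sum.elim (fun b => G.IsLink b x y) (fun c => p c = s(x, y)) e
  isLink_symm e _ := ⟨fun x y h => by
    cases e with
    | inl b => exact IsLink.symm h
    | inr c => exact Eq.trans h Sym2.eq_swap⟩
  eq_or_eq_of_isLink_of_isLink e x y v w h h' := by
    cases e with
    | inl b => exact G.eq_or_eq_of_isLink_of_isLink h h'
    | inr c =>
      have hx : x ∈ s(v, w) := by
        have h1 : p c = s(x, y) := h
        have h2 : p c = s(v, w) := h'
        rw [← h2, h1]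
        exact Sym2.mem_mk_left x y
      exact Sym2.mem_iff.1 hx
  left_mem_of_isLink e x y h := by
    cases e with
    | inl b => exact Or.inl (IsLink.left_mem h)
    | inr c =>
      have h1 : p c = s(x, y) := h
      exact Or.inr ⟨c, by rw [h1]; exact Sym2.mem_mk_left x y⟩

end Graph

/-- The vertices of `H₃` other than its free nodes, i.e. the vertices of `K_{2,3}`: three 2-valent
vertices `mid j` and two 3-valent vertices `hub b`. -/
inductive H3Inner : Type
  | mid (j : Fin 3)
  | hub (b : Bool)

/-- The edges of `H₃`: the three free edges and the six edges of `K_{2,3}`. -/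
inductive H3Edge : Type
  | free (j : Fin 3)
  | core (j : Fin 3) (b : Bool)

/-- The ends of the edges of `H₃`, whose vertices are the free nodes `Sum.inl j` and the vertices
of `K_{2,3}`. -/
def H3Edge.ends : H3Edge → Sym2 (Fin 3 ⊕ H3Inner)
  | .free j => s(Sum.inl j, Sum.inr (.mid j))
  | .core j b => s(Sum.inr (.mid j), Sum.inr (.hub b))

namespace Graph

/-- The scaffolded graph `H(G, T)`, where the `i`-th triple of `T` is `{t i 0, t i 1, t i 2}`: one
copy of `H₃` is added for each `i`, its three free nodes being identified with the triple. -/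
def scaffold {α β : Type*} (G : Graph α β) {n : ℕ} (t : Fin n → Fin 3 → α) :
    Graph (α ⊕ Fin n × H3Inner) (β ⊕ Fin n × H3Edge) :=
  (G.map Sum.inl).addEdges fun q : Fin n × H3Edge => q.2.ends.map (Sum.map (t q.1) (Prod.mk q.1))

/-- The graph in `S(G, T)` obtained by adding, for each `i`, an edge between the two vertices of
the `i`-th triple other than `t i (c i)`. -/
def addChords {α β : Type*} (G : Graph α β) {n : ℕ} (t : Fin n → Fin 3 → α) (c : Fin n → Fin 3) :
    Graph α (β ⊕ Fin n) :=
  G.addEdges fun i => s(t i (c i + 1), t i (c i + 2))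

/-- The minimum genus over the `3 ^ n` graphs in `S(G, T)`. -/
noncomputable def chordGenus {α β : Type*} (G : Graph α β) {n : ℕ} (t : Fin n → Fin 3 → α) : ℕ :=
  ⨅ c : Fin n → Fin 3, (G.addChords t c).genus

end Graph

/-! A graph is encoded by its darts `D`, the reversal `φ` and the base points `b`; a rotation system
is a permutation `ρ` whose cycles are the fibres of `b`, and its faces are the cycles of `ρ * φ`.
Identifying a 1-valent node with a vertex multiplies `ρ`, hence also `ρ * φ`, by one transposition.
A transposition joins two cycles or splits one, so each identification changes the face count by
exactly one. Every rotation system of a scaffolded or chorded graph arises in this way from one of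
`G` and one of `H₃`, respectively of a single edge, which has one face.

For one triple, let `F` and `K` be the face permutations on `G` and on `H₃`. By Euler's formula `K`
has 1 or 3 cycles, and if it has 3 then no face meets all three free nodes. Two identifications
restore the face count `F + K` if the two corners share a face on both sides, and otherwise reduce
it by 2. Upper bound (`exists_chord_faceCount_of_scaffold`): if two of the three corners share a
face of `F`, a chord there gives `F + 1` faces, while `H₃` gives at most `F + 2`, by the fact on
free nodes. If no two share a face, `H₃` gives `F + K - 3` and any chord `F - 1`. Lower bound
(`exists_scaffold_faceCount_of_chord`): replace the chord by a planar `H₃` with the corresponding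
two free nodes on one face. This gains two faces, and the third identification loses at most one.

So the best face counts differ by exactly one per triple, and induction exchanges the triples one by
one. A copy of `H₃` adds 5 vertices and 9 edges, a chord only one edge, and neither changes the
number of components; Euler's formula turns a difference of `n` faces into a difference of `(9n - 5n
- n - n) / 2 = n` in genus. -/

section

/-! ### Cycles of a permutation multiplied by a transposition -/

open Equiv

/-- The equivalence relation obtained from `r` by identifying `x` and `y`. -/
def Setoid.glue {V : Type*} (r : Setoid V) (x y : V) : Setoid V where
  r a b := r a b ∨ (r a x ∧ r b y) ∨ (r a y ∧ r b x)
  iseqv := by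
    refine ⟨fun a => Or.inl (r.refl a), ?_, ?_⟩
    · rintro a b (h | h | h)
      · exact Or.inl (r.symm h)
      · exact Or.inr (Or.inr h.symm)
      · exact Or.inr (Or.inl h.symm)
    · intro a b c h h'
      have tr : ∀ {p q s}, r p q → r q s → r p s := fun h1 h2 => r.trans h1 h2
      have sy : ∀ {p q}, r p q → r q p := fun h1 => r.symm h1
      rcases h with h | ⟨h1, h2⟩ | ⟨h1, h2⟩ <;> rcases h' with h' | ⟨h3, h4⟩ | ⟨h3, h4⟩
      · exact Or.inl (tr h h')
      · exact Or.inr (Or.inl ⟨tr h h3, h4⟩)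
      · exact Or.inr (Or.inr ⟨tr h h3, h4⟩)
      · exact Or.inr (Or.inl ⟨h1, tr (sy h') h2⟩)
      · exact Or.inl (tr h1 (tr (tr (sy h3) h2) (sy h4)))
      · exact Or.inl (tr h1 (sy h4))
      · exact Or.inr (Or.inr ⟨h1, tr (sy h') h2⟩)
      · exact Or.inl (tr h1 (sy h4))
      · exact Or.inl (tr h1 (tr (tr (sy h3) h2) (sy h4)))

theorem Setoid.glue_rel {V : Type*} {r : Setoid V} {x y a b : V} :
    r.glue x y a b ↔ r a b ∨ (r a x ∧ r b y) ∨ (r a y ∧ r b x) := Iff.rfl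

theorem Setoid.le_glue {V : Type*} (r : Setoid V) (x y : V) : r ≤ r.glue x y :=
  fun _ _ h => Or.inl h

theorem Setoid.glue_self {V : Type*} (r : Setoid V) (x y : V) : r.glue x y x y :=
  Or.inr (Or.inl ⟨r.refl x, r.refl y⟩)

theorem Setoid.glue_le {V : Type*} {r s : Setoid V} {x y : V} (h : r ≤ s) (hxy : s x y) :
    r.glue x y ≤ s := by
  rintro a b (h1 | ⟨h1, h2⟩ | ⟨h1, h2⟩)
  · exact h h1
  · exact s.trans (h h1) (s.trans hxy (s.symm (h h2)))
  · exact s.trans (h h1) (s.trans (s.symm hxy) (s.symm (h h2)))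

theorem Setoid.glue_eq_self {V : Type*} {r : Setoid V} {x y : V} (h : r x y) : r.glue x y = r :=
  le_antisymm (Setoid.glue_le le_rfl h) (r.le_glue x y)

/-- Once the class of `y` is dropped, each remaining class represents exactly one glued class, with
the class of `x` standing for the merged one. -/
theorem Setoid.card_quotient_glue {V : Type*} [Finite V] {r : Setoid V} {x y : V}
    (h : ¬ r x y) : Nat.card (Quotient (r.glue x y)) + 1 = Nat.card (Quotient r) := by
  classical
  have e : Quotient (r.glue x y) ≃ {q : Quotient r // q ≠ Quotient.mk r y} := by
    refine Equiv.symm (Equiv.ofBijective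
      (fun q => Quotient.map' id (fun a b hab => Or.inl hab) q.1) ⟨?_, ?_⟩)
    · rintro ⟨a, ha⟩ ⟨b, hb⟩ hab
      induction a using Quotient.inductionOn with | _ a
      induction b using Quotient.inductionOn with | _ b
      have h1 : r.glue x y a b := Quotient.exact hab
      have ha' : ¬ r a y := fun h => ha (Quotient.sound h)
      have hb' : ¬ r b y := fun h => hb (Quotient.sound h)
      rcases h1 with h1 | h1 | h1
      · exact Subtype.ext (Quotient.sound h1)
      · exact absurd h1.2 hb'
      · exact absurd h1.1 ha'
    · intro q
      induction q using Quotient.inductionOn with | _ a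
      by_cases hay : r a y
      · refine ⟨⟨Quotient.mk r x, fun hx => h (Quotient.exact hx)⟩, ?_⟩
        exact Quotient.sound (Or.inr (Or.inl ⟨r.refl x, hay⟩))
      · exact ⟨⟨Quotient.mk r a, fun hx => hay (Quotient.exact hx)⟩, rfl⟩
  rw [Nat.card_congr e]
  have := Fintype.ofFinite (Quotient r)
  rw [Nat.card_eq_fintype_card, Nat.card_eq_fintype_card]
  have := Fintype.card_subtype_compl (fun q : Quotient r => q = Quotient.mk r y)
  simp only [Fintype.card_unique] at this
  rw [this]
  have : 0 < Fintype.card (Quotient r) := Fintype.card_pos_iff.2 ⟨Quotient.mk r y⟩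
  omega

namespace Equiv.Perm

/-- The number of cycles of a permutation, fixed points included. -/
noncomputable def numCycles {D : Type*} (σ : Perm D) : ℕ :=
  Nat.card (Quotient (SameCycle.setoid σ))

theorem setoid_rel {D : Type*} {σ : Perm D} {a b : D} :
    SameCycle.setoid σ a b ↔ σ.SameCycle a b := Iff.rfl

theorem setoid_le_iff {D : Type*} {σ : Perm D} {s : Setoid D} :
    SameCycle.setoid σ ≤ s ↔ ∀ d, s d (σ d) := by
  refine ⟨fun h d => h ⟨1, by simp⟩, fun h => ?_⟩
  have key : ∀ (n : ℕ) d, s d ((σ ^ n) d) := by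
    intro n
    induction n with
    | zero => intro d; exact s.refl d
    | succ n ih =>
      intro d
      rw [pow_succ', Perm.mul_apply]
      exact s.trans (ih d) (h _)
  rintro a b ⟨n, hn⟩
  obtain ⟨m, rfl | rfl⟩ := n.eq_nat_or_neg
  · rw [← hn, zpow_natCast]; exact key m a
  · have : (σ ^ m) b = a := by rw [← hn, zpow_neg, zpow_natCast, ← Perm.mul_apply]; simp
    rw [← this]; exact s.symm (key m b)

theorem sameCycle_conj_equiv {D D' : Type*} (e : D ≃ D') (σ : Perm D) (a b : D) :
    (e.permCongr σ).SameCycle (e a) (e b) ↔ σ.SameCycle a b := by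
  have h : ∀ n : ℤ, (e.permCongr σ) ^ n = e.permCongr (σ ^ n) := fun n =>
    (map_zpow e.permCongrHom σ n).symm
  simp only [SameCycle, h, permCongr_apply, symm_apply_apply, e.apply_eq_iff_eq]

theorem numCycles_permCongr {D D' : Type*} (e : D ≃ D') (σ : Perm D) :
    (e.permCongr σ).numCycles = σ.numCycles :=
  (Nat.card_congr (Quotient.congr e fun a b => (sameCycle_conj_equiv e σ a b).symm)).symm

variable {D : Type*} [DecidableEq D]

theorem setoid_mul_swap_le (σ : Perm D) (x y : D) :
    SameCycle.setoid (σ * swap x y) ≤ (SameCycle.setoid σ).glue x y := by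
  rw [setoid_le_iff]
  intro d
  set s := (SameCycle.setoid σ).glue x y
  have hs : ∀ a, s a (σ a) := setoid_le_iff.1 (Setoid.le_glue _ x y)
  have hxy : s x y := Setoid.glue_self _ x y
  rw [Perm.mul_apply]
  rcases eq_or_ne d x with rfl | hx
  · rw [swap_apply_left]; exact s.trans hxy (hs _)
  rcases eq_or_ne d y with rfl | hy
  · rw [swap_apply_right]; exact s.trans (s.symm hxy) (hs _)
  rw [swap_apply_of_ne_of_ne hx hy]; exact hs _

theorem glue_setoid_mul_swap (σ : Perm D) (x y : D) :
    (SameCycle.setoid (σ * swap x y)).glue x y = (SameCycle.setoid σ).glue x y := by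
  refine le_antisymm (Setoid.glue_le (setoid_mul_swap_le σ x y) (Setoid.glue_self _ x y)) ?_
  have := setoid_mul_swap_le (σ * swap x y) x y
  rw [mul_assoc, swap_mul_self, mul_one] at this
  exact Setoid.glue_le this (Setoid.glue_self _ x y)

/-- Starting at `y`, the new permutation jumps to `σ x` and then follows the old cycle of `x`, which
avoids `y`, until its first return to `x`. -/
theorem sameCycle_mul_swap_of_not [Finite D] {σ : Perm D} {x y : D} (h : ¬ σ.SameCycle x y) :
    (σ * swap x y).SameCycle x y := by
  have key : ∀ n : ℕ, (∀ i, 0 < i → i < n → (σ ^ i) x ≠ x) → 0 < n →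
      ((σ * swap x y) ^ n) y = (σ ^ n) x := by
    intro n hn h0
    induction n with
    | zero => omega
    | succ n ih =>
      rcases Nat.eq_zero_or_pos n with rfl | hpos
      · simp
      · rw [pow_succ', Perm.mul_apply, ih (fun i hi hi' => hn i hi (by omega)) hpos,
          Perm.mul_apply, swap_apply_of_ne_of_ne (hn n hpos (by omega)), pow_succ',
          Perm.mul_apply]
        intro hy
        exact h ⟨n, by simpa using hy⟩
  have hex : ∃ n : ℕ, 0 < n ∧ (σ ^ n) x = x :=
    ⟨orderOf σ, orderOf_pos σ, by rw [pow_orderOf_eq_one]; rfl⟩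
  classical
  obtain ⟨h1, h2⟩ := Nat.find_spec hex
  refine SameCycle.symm ⟨(Nat.find hex : ℕ), ?_⟩
  rw [zpow_natCast, key _ (fun i hi hi' hx => Nat.find_min hex hi' ⟨hi, hx⟩) h1, h2]

/-- With `k` the first time that `σ ^ k` takes `x` to `y`, the arc `σ x, …, σ ^ k x = y` misses `x`
and is closed under the new permutation, which sends `y` back to `σ x`. -/
theorem not_sameCycle_mul_swap [Finite D] {σ : Perm D} {x y : D} (hxy : x ≠ y)
    (h : σ.SameCycle x y) : ¬ (σ * swap x y).SameCycle x y := by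
  classical
  have hex : ∃ n : ℕ, 0 < n ∧ (σ ^ n) x = y := by
    obtain ⟨n, hn, -, h⟩ := h.exists_pow_eq'' 
    exact ⟨n, hn, h⟩
  obtain ⟨h1, h2⟩ := Nat.find_spec hex
  have hmin : ∀ i, 0 < i → i < Nat.find hex → (σ ^ i) x ≠ y :=
    fun i hi hi' hx => Nat.find_min hex hi' ⟨hi, hx⟩
  set k := Nat.find hex
  have hx : ∀ i, 0 < i → i ≤ k → (σ ^ i) x ≠ x := by
    intro i hi hik hx
    rcases hik.eq_or_lt with rfl | hlt
    · exact hxy (hx.symm.trans h2)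
    · apply hmin (k - i) (by omega) (by omega)
      rw [← h2]
      conv_rhs => rw [show k = (k - i) + i by omega, pow_add, Perm.mul_apply, hx]
  let S : Setoid D := Setoid.ker fun d => ∃ i, 0 < i ∧ i ≤ k ∧ (σ ^ i) x = d
  have hS : ∀ d, (∃ i, 0 < i ∧ i ≤ k ∧ (σ ^ i) x = d) →
      ∃ i, 0 < i ∧ i ≤ k ∧ (σ ^ i) x = (σ * swap x y) d := by
    rintro d ⟨i, hi, hik, rfl⟩
    rcases hik.eq_or_lt with rfl | hlt
    · exact ⟨1, one_pos, h1, by rw [h2]; simp⟩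
    · refine ⟨i + 1, by omega, hlt, ?_⟩
      rw [Perm.mul_apply, swap_apply_of_ne_of_ne (hx i hi hik) (hmin i hi hlt), pow_succ',
        Perm.mul_apply]
  rintro ⟨n, hn⟩
  have hinv : ∀ n : ℕ, ∃ i, 0 < i ∧ i ≤ k ∧ (σ ^ i) x = ((σ * swap x y) ^ n) y := by
    intro n
    induction n with
    | zero => exact ⟨k, h1, le_rfl, h2⟩
    | succ n ih => rw [pow_succ', Perm.mul_apply]; exact hS _ ih
  obtain ⟨m, -, -, hm⟩ := (SameCycle.symm ⟨n, hn⟩ : (σ * swap x y).SameCycle y x).exists_pow_eq''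
  obtain ⟨i, hi, hik, h⟩ := hinv m
  exact hx i hi hik (h.trans hm)

theorem setoid_mul_swap [Finite D] {σ : Perm D} {x y : D} (h : ¬ σ.SameCycle x y) :
    SameCycle.setoid (σ * swap x y) = (SameCycle.setoid σ).glue x y := by
  rw [← glue_setoid_mul_swap, Setoid.glue_eq_self]
  exact sameCycle_mul_swap_of_not h

theorem numCycles_mul_swap_of_not [Finite D] {σ : Perm D} {x y : D} (h : ¬ σ.SameCycle x y) :
    (σ * swap x y).numCycles + 1 = σ.numCycles := by
  rw [numCycles, setoid_mul_swap h, Setoid.card_quotient_glue h, numCycles]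

theorem numCycles_mul_swap [Finite D] {σ : Perm D} {x y : D} (hxy : x ≠ y)
    (h : σ.SameCycle x y) : (σ * swap x y).numCycles = σ.numCycles + 1 := by
  have := numCycles_mul_swap_of_not (not_sameCycle_mul_swap hxy h)
  rw [mul_assoc, swap_mul_self, mul_one] at this
  exact this.symm

theorem numCycles_mul_swap_le [Finite D] (σ : Perm D) (x y : D) :
    (σ * swap x y).numCycles ≤ σ.numCycles + 1 := by
  rcases eq_or_ne x y with rfl | hxy
  · rw [swap_self, ← Perm.one_def, mul_one]; omega
  by_cases h : σ.SameCycle x y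
  · exact (numCycles_mul_swap hxy h).le
  · have := numCycles_mul_swap_of_not h; omega

theorem le_numCycles_mul_swap [Finite D] (σ : Perm D) (x y : D) :
    σ.numCycles ≤ (σ * swap x y).numCycles + 1 := by
  have := numCycles_mul_swap_le (σ * swap x y) x y
  rwa [mul_assoc, swap_mul_self, mul_one] at this

end Equiv.Perm

end

/-! ### Rotation systems as permutations, and the identification of 1-valent nodes with vertices -/

section

open Equiv

namespace Equiv.Perm

theorem not_sameCycle_of_invariant {D : Type*} {σ : Perm D} {x y : D} (p : D → Prop)
    (hp : ∀ d, p (σ d) ↔ p d) (hx : p x) (hy : ¬ p y) : ¬ σ.SameCycle x y := fun h =>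
  have : SameCycle.setoid σ ≤ Setoid.ker p :=
    setoid_le_iff.2 fun d => propext (hp d).symm
  hy ((this h : p x = p y) ▸ hx)

theorem sameCycle_sumCongr_inl {D D' : Type*} {σ : Perm D} {τ : Perm D'} {a b : D} :
    (sumCongr σ τ).SameCycle (.inl a) (.inl b) ↔ σ.SameCycle a b := by
  have h : ∀ n : ℤ, (sumCongr σ τ) ^ n = sumCongr (σ ^ n) (τ ^ n) := fun n =>
    (map_zpow (sumCongrHom D D') (σ, τ) n).symm
  simp only [SameCycle, h, sumCongr_apply, Sum.map_inl, Sum.inl.injEq]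

theorem sameCycle_sumCongr_inr {D D' : Type*} {σ : Perm D} {τ : Perm D'} {a b : D'} :
    (sumCongr σ τ).SameCycle (.inr a) (.inr b) ↔ τ.SameCycle a b := by
  have h : ∀ n : ℤ, (sumCongr σ τ) ^ n = sumCongr (σ ^ n) (τ ^ n) := fun n =>
    (map_zpow (sumCongrHom D D') (σ, τ) n).symm
  simp only [SameCycle, h, sumCongr_apply, Sum.map_inr, Sum.inr.injEq]

theorem not_sameCycle_sumCongr {D D' : Type*} {σ : Perm D} {τ : Perm D'} {a : D} {b : D'} :
    ¬ (sumCongr σ τ).SameCycle (.inl a) (.inr b) :=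
  not_sameCycle_of_invariant (fun d => d.isLeft) (by simp) rfl (by simp)

theorem numCycles_sumCongr {D D' : Type*} [Finite D] [Finite D'] (σ : Perm D) (τ : Perm D') :
    (sumCongr σ τ).numCycles = σ.numCycles + τ.numCycles := by
  unfold numCycles
  rw [← Nat.card_sum]
  refine (Nat.card_congr (Equiv.ofBijective (Sum.elim
    (Quotient.map' (s₁ := SameCycle.setoid σ) Sum.inl fun a b h => sameCycle_sumCongr_inl.2 h)
    (Quotient.map' (s₁ := SameCycle.setoid τ) Sum.inr fun a b h => sameCycle_sumCongr_inr.2 h))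
    ⟨?_, ?_⟩)).symm
  · rintro (a | a) (b | b) h <;> induction a using Quotient.inductionOn with | _ a <;>
      induction b using Quotient.inductionOn with | _ b
    · exact congrArg Sum.inl (Quotient.sound (sameCycle_sumCongr_inl.1 (Quotient.exact h)))
    · exact absurd (Quotient.exact h) not_sameCycle_sumCongr
    · exact absurd (Quotient.exact h.symm) not_sameCycle_sumCongr
    · exact congrArg Sum.inr (Quotient.sound (sameCycle_sumCongr_inr.1 (Quotient.exact h)))
  · intro q
    induction q using Quotient.inductionOn with | _ d
    rcases d with d | d
    · exact ⟨.inl (Quotient.mk _ d), rfl⟩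
    · exact ⟨.inr (Quotient.mk _ d), rfl⟩

/-- `ρ` cyclically orders every fibre of `b`. -/
def IsRotation {D V : Type*} (b : D → V) (ρ : Perm D) : Prop :=
  ∀ d d', ρ.SameCycle d d' ↔ b d = b d'

/-- The numbers of faces of the rotation systems of the graph with darts `D`, dart reversal `φ` and
base points `b`. -/
def faceCounts {D V : Type*} (φ : Perm D) (b : D → V) : Set ℕ :=
  {F | ∃ ρ : Perm D, IsRotation b ρ ∧ (ρ * φ).numCycles = F}

theorem IsRotation.setoid_eq {D V : Type*} {b : D → V} {ρ : Perm D} (h : IsRotation b ρ) :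
    SameCycle.setoid ρ = Setoid.ker b := Setoid.ext h

theorem isRotation_iff {D V : Type*} {b : D → V} {ρ : Perm D} :
    IsRotation b ρ ↔ SameCycle.setoid ρ = Setoid.ker b :=
  ⟨fun h => h.setoid_eq, fun h d d' => by rw [← setoid_rel, h]; rfl⟩

theorem IsRotation.base_apply {D V : Type*} {b : D → V} {ρ : Perm D} (h : IsRotation b ρ) (d : D) :
    b (ρ d) = b d := (h _ _).1 (sameCycle_apply_left.2 (SameCycle.refl _ _))

theorem faceCounts_congr {D D' V V' : Type*} {φ : Perm D} {φ' : Perm D'} {b : D → V} {b' : D' → V'}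
    (e : D ≃ D') (hφ : ∀ d, e (φ d) = φ' (e d))
    (hb : ∀ d d', b d = b d' ↔ b' (e d) = b' (e d')) : faceCounts φ b = faceCounts φ' b' := by
  have key : ∀ ρ : Perm D, (e.permCongr ρ * φ').numCycles = (ρ * φ).numCycles := by
    intro ρ
    rw [← numCycles_permCongr e]
    congr 1
    ext d
    simp only [Perm.mul_apply, permCongr_apply]
    rw [← Equiv.apply_symm_apply e d, ← hφ]; simp
  ext F
  constructor
  · rintro ⟨ρ, hρ, rfl⟩
    refine ⟨e.permCongr ρ, fun d d' => ?_, key ρ⟩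
    obtain ⟨d, rfl⟩ := e.surjective d
    obtain ⟨d', rfl⟩ := e.surjective d'
    rw [sameCycle_conj_equiv, hρ, hb]
  · rintro ⟨ρ, hρ, rfl⟩
    obtain ⟨ρ, rfl⟩ := e.permCongr.surjective ρ
    refine ⟨ρ, fun d d' => ?_, (key ρ).symm⟩
    rw [hb, ← hρ, sameCycle_conj_equiv]

theorem exists_isRotation {D V : Type*} [Finite D] (b : D → V) : ∃ ρ : Perm D, IsRotation b ρ := by
  classical
  -- Among the permutations preserving the fibres, take one with fewest cycles: two cycles in one
  -- fibre could be joined by a transposition.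
  have hex : ∃ n, ∃ ρ : Perm D, SameCycle.setoid ρ ≤ Setoid.ker b ∧ ρ.numCycles = n :=
    ⟨_, 1, setoid_le_iff.2 fun d => rfl, rfl⟩
  obtain ⟨ρ, hle, hn⟩ := Nat.find_spec hex
  refine ⟨ρ, fun d d' => ⟨fun h => hle h, fun h => ?_⟩⟩
  by_contra hnot
  have h1 := numCycles_mul_swap_of_not hnot
  refine Nat.find_min hex (m := (ρ * swap d d').numCycles) (by omega) ⟨_, ?_, rfl⟩
  rw [setoid_mul_swap hnot]
  exact Setoid.glue_le hle h

theorem faceCounts_nonempty {D V : Type*} [Finite D] (φ : Perm D) (b : D → V) :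
    (faceCounts φ b).Nonempty :=
  let ⟨ρ, hρ⟩ := exists_isRotation b
  ⟨_, ρ, hρ, rfl⟩

/-- The base points in the union of two graphs in which the vertices `inl i` of the second,
for `i ∈ A`, are identified with the vertices `u i` of the first. -/
noncomputable def glueBase {D D' V W ι : Type*} (b : D → V) (b' : D' → ι ⊕ W) (u : ι → V) (A : Set ι) :
    D ⊕ D' → V ⊕ (ι ⊕ W) := by
  classical
  exact Sum.elim (fun d => .inl (b d)) fun d =>
    Sum.elim (fun i => if i ∈ A then .inl (u i) else .inr (.inl i)) (fun w => .inr (.inr w)) (b' d)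

section glue

variable {D D' V W ι : Type*} {b : D → V} {b' : D' → ι ⊕ W} {u : ι → V} {A : Set ι}
  {f : ι → D'}

theorem glueBase_free (hf : ∀ d i, b' d = .inl i ↔ d = f i) (i : ι) [Decidable (i ∈ A)] :
    glueBase b b' u A (.inr (f i)) = if i ∈ A then .inl (u i) else .inr (.inl i) := by
  have : b' (f i) = .inl i := (hf _ _).2 rfl
  simp only [glueBase, Sum.elim_inr, this, Sum.elim_inl]
  congr

theorem glueBase_eq_inl_iff (hf : ∀ d i, b' d = .inl i ↔ d = f i) (hu : Function.Injective u)
    {i : ι} (hi : i ∈ A) (x : D ⊕ D') :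
    glueBase b b' u A x = .inl (u i) ↔ (∃ d, x = .inl d ∧ b d = u i) ∨ x = .inr (f i) := by
  classical
  rcases x with d | d
  · simp [glueBase]
  · rcases h : b' d with j | w
    · obtain rfl := (hf _ _).1 h
      rw [glueBase_free hf]
      split_ifs with hj
      · simp only [Sum.inl.injEq, hu.eq_iff, false_and, exists_false, false_or,
          Sum.inr.injEq]
        refine ⟨fun h => h ▸ rfl, fun h => ?_⟩
        have := (hf (f j) i).2 h
        rw [(hf _ _).2 rfl] at this
        exact Sum.inl_injective this
      · simp only [false_and, exists_false, false_or, Sum.inr.injEq, false_iff]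
        intro h
        have := (hf (f j) i).2 h
        rw [(hf _ _).2 rfl] at this
        exact hj (Sum.inl_injective this ▸ hi)
    · simp only [glueBase, Sum.elim_inr, h, reduceCtorEq, false_and, exists_false, false_or,
        Sum.inr.injEq, false_iff]
      rintro rfl
      rw [(hf _ _).2 rfl] at h
      cases h

theorem glueBase_insert_eq (hf : ∀ d i, b' d = .inl i ↔ d = f i) {i : ι} {x : D ⊕ D'}
    (hx : x ≠ .inr (f i)) : glueBase b b' u (insert i A) x = glueBase b b' u A x := by
  classical
  rcases x with d | d
  · rfl
  · rcases h : b' d with j | w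
    · have hj : j ≠ i := by
        rintro rfl
        exact hx (congrArg _ ((hf _ _).1 h))
      simp only [glueBase, Sum.elim_inr, h, Sum.elim_inl, Set.mem_insert_iff, hj, false_or]
    · simp only [glueBase, Sum.elim_inr, h]

theorem glueBase_eq_inr_inl_iff (hf : ∀ d i, b' d = .inl i ↔ d = f i) {i : ι} (hi : i ∉ A)
    (x : D ⊕ D') : glueBase b b' u A x = .inr (.inl i) ↔ x = .inr (f i) := by
  classical
  refine ⟨fun h => ?_, fun h => by rw [h, glueBase_free hf, if_neg hi]⟩
  rcases x with d | d
  · simp [glueBase] at h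
  · rcases h' : b' d with j | w
    · simp only [glueBase, Sum.elim_inr, h', Sum.elim_inl] at h
      split_ifs at h
      obtain rfl : j = i := by simpa using h
      rw [(hf _ _).1 h']
    · simp [glueBase, h'] at h

theorem ker_glueBase_insert (hf : ∀ d i, b' d = .inl i ↔ d = f i)
    {i : ι} (hi : i ∉ A) {d : D} (hd : b d = u i) :
    Setoid.ker (glueBase b b' u (insert i A)) =
      (Setoid.ker (glueBase b b' u A)).glue (.inl d) (.inr (f i)) := by
  classical
  have h1 : glueBase b b' u (insert i A) (.inr (f i)) = .inl (u i) := by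
    rw [glueBase_free hf, if_pos (Set.mem_insert i A)]
  have h2 : glueBase b b' u A (.inr (f i)) = .inr (.inl i) := by
    rw [glueBase_free hf, if_neg hi]
  have h3 : ∀ A : Set ι, glueBase b b' u A (.inl d) = .inl (u i) := by
    intro A; simp [glueBase, hd]
  ext x y
  rw [Setoid.glue_rel]
  simp only [Setoid.ker_def]
  rw [h2, h3 A, glueBase_eq_inr_inl_iff hf hi, glueBase_eq_inr_inl_iff hf hi]
  by_cases hx : x = .inr (f i) <;> by_cases hy : y = .inr (f i)
  · subst hx hy; simp
  · subst hx
    rw [h1, glueBase_insert_eq hf hy, h2, eq_comm (a := Sum.inr (Sum.inl i)),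
      glueBase_eq_inr_inl_iff hf hi]
    simp [hy, eq_comm]
  · subst hy
    rw [h1, glueBase_insert_eq hf hx, h2, glueBase_eq_inr_inl_iff hf hi]
    simp [hx]
  · rw [glueBase_insert_eq hf hx, glueBase_insert_eq hf hy]
    simp [hx, hy]

/-- The dart `f i` is alone at its node, hence a fixed point of `ρ`; the transposition inserts it
directly after `d` in the cyclic order. The set `A` of nodes already identified grows by one node at
a time. -/
theorem IsRotation.attach [Finite D] [Finite D'] [DecidableEq D] [DecidableEq D']
    {ρ : Perm (D ⊕ D')} (hf : ∀ d i, b' d = .inl i ↔ d = f i)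
    {i : ι} (hi : i ∉ A) {d : D} (hd : b d = u i)
    (h : IsRotation (glueBase b b' u A) ρ) :
    IsRotation (glueBase b b' u (insert i A)) (ρ * swap (.inl d) (.inr (f i))) := by
  rw [isRotation_iff, ker_glueBase_insert hf hi hd, setoid_mul_swap, h.setoid_eq]
  rw [h, eq_comm, (glueBase_eq_inr_inl_iff hf hi (.inr (f i))).2 rfl, eq_comm,
    glueBase_eq_inr_inl_iff hf hi]
  simp

/-- Inverse of `attach`: take `d` to be the predecessor of `f i` in the rotation. It comes from `D`,
because `u i` carries some dart of `D` and, `u` being injective, `f i` is the only dart of `D'`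
there. -/
theorem IsRotation.detach [Finite D] [Finite D'] [DecidableEq D] [DecidableEq D']
    {ρ : Perm (D ⊕ D')} (hf : ∀ d i, b' d = .inl i ↔ d = f i)
    (hu : Function.Injective u) {i : ι} (hi : i ∉ A) (hr : u i ∈ Set.range b)
    (h : IsRotation (glueBase b b' u (insert i A)) ρ) :
    ∃ d : D, b d = u i ∧
      IsRotation (glueBase b b' u A) (ρ * swap (.inl d) (.inr (f i))) := by
  set y : D ⊕ D' := .inr (f i) with hy
  have hbase := glueBase_eq_inl_iff (b := b) hf hu (Set.mem_insert i A)
  have hby : glueBase b b' u (insert i A) y = .inl (u i) := (hbase y).2 (Or.inr rfl)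
  obtain ⟨d₀, hd₀⟩ := hr
  have hs : ρ.SameCycle y (.inl d₀) := by
    rw [h, hby]; simp [glueBase, hd₀]
  have hne : ρ⁻¹ y ≠ y := by
    intro hfix
    have : ρ y = y := by conv_lhs => rw [← hfix]; simp
    have := hs.eq_of_left this
    simp [hy] at this
  have hbi : glueBase b b' u (insert i A) (ρ⁻¹ y) = .inl (u i) := by
    rw [← hby, ← h.base_apply (ρ⁻¹ y)]; simp
  obtain ⟨d, hd, hdu⟩ := ((hbase _).1 hbi).resolve_right hne
  refine ⟨d, hdu, ?_⟩
  set τ := ρ * swap (.inl d) y with hτ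
  have hτy : τ y = y := by rw [hτ, Perm.mul_apply, swap_apply_right, ← hd]; simp
  have hnot : ¬ τ.SameCycle (.inl d) y := fun hsc => by
    have := hsc.eq_of_right hτy
    simp [hy] at this
  have hρ : ρ = τ * swap (.inl d) y := by rw [hτ, mul_assoc, swap_mul_self, mul_one]
  have hset : Setoid.ker (glueBase b b' u (insert i A)) =
      (SameCycle.setoid τ).glue (.inl d) y := by
    rw [← setoid_mul_swap hnot, ← hρ, h.setoid_eq]
  have hyiff : ∀ x, τ.SameCycle x y ↔ x = y := fun x =>
    ⟨fun hx => hx.eq_of_right hτy, fun hx => hx ▸ SameCycle.refl _ _⟩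
  have hbiff := glueBase_eq_inr_inl_iff (b := b) (u := u) hf hi
  intro x z
  by_cases hx : x = y
  · rw [hx, sameCycle_comm, hyiff, (hbiff y).2 rfl, eq_comm (b := glueBase b b' u A z), hbiff]
  by_cases hz : z = y
  · rw [hz, hyiff, (hbiff y).2 rfl, hbiff]
  rw [← glueBase_insert_eq (b := b) (u := u) hf hx, ← glueBase_insert_eq (b := b) (u := u) hf hz,
    ← Setoid.ker_def, hset, Setoid.glue_rel]
  simp only [setoid_rel, hyiff, hx, hz, and_false, false_and, or_false]

theorem IsRotation.sumCongr {ρ : Perm D} {ρ' : Perm D'} (h : IsRotation b ρ)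
    (h' : IsRotation b' ρ') : IsRotation (glueBase b b' u ∅) (Perm.sumCongr ρ ρ') := by
  have hg : ∀ d, glueBase b b' u ∅ (.inr d) = .inr (b' d) := fun d => by
    rcases hd : b' d with i | w <;> simp [glueBase, hd]
  rintro (d | d) (d' | d')
  · rw [sameCycle_sumCongr_inl, h]; simp [glueBase]
  · rw [hg]; simp [not_sameCycle_sumCongr, glueBase]
  · rw [hg, sameCycle_comm]; simp [not_sameCycle_sumCongr, glueBase]
  · rw [sameCycle_sumCongr_inr, h', hg, hg]; simp

theorem IsRotation.exists_sumCongr [Finite D] [Finite D'] {ρ : Perm (D ⊕ D')}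
    (h : IsRotation (glueBase b b' u ∅) ρ) :
    ∃ ρ₁ ρ₂, IsRotation b ρ₁ ∧ IsRotation b' ρ₂ ∧ ρ = Perm.sumCongr ρ₁ ρ₂ := by
  have hg : ∀ d, glueBase b b' u ∅ (.inr d) = .inr (b' d) := fun d => by
    rcases hd : b' d with i | w <;> simp [glueBase, hd]
  have hl : Set.MapsTo ρ (Set.range Sum.inl) (Set.range Sum.inl) := by
    rintro _ ⟨d, rfl⟩
    have := h.base_apply (.inl d)
    rcases hx : ρ (.inl d) with d' | d'
    · exact ⟨d', rfl⟩
    · rw [hx, hg] at this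
      simp [glueBase] at this
  obtain ⟨⟨ρ₁, ρ₂⟩, hρ⟩ := mem_sumCongrHom_range_of_perm_mapsTo_inl hl
  have hρ' : ρ = Perm.sumCongr ρ₁ ρ₂ := hρ.symm
  refine ⟨ρ₁, ρ₂, fun d d' => ?_, fun d d' => ?_, hρ'⟩
  · rw [← sameCycle_sumCongr_inl (τ := ρ₂), ← hρ', h]; simp [glueBase]
  · rw [← sameCycle_sumCongr_inr (σ := ρ₁), ← hρ', h, hg, hg]; simp

end glue

/-- This carries an identification over to the face permutation: a transposition of darts in the
rotation becomes one of the reversed darts among the faces. -/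
theorem mul_swap_mul_involutive {D : Type*} [DecidableEq D] {ρ φ : Perm D}
    (hφ : Function.Involutive φ) (x y : D) :
    ρ * swap x y * φ = ρ * φ * swap (φ x) (φ y) := by
  have : φ⁻¹ = φ := by ext d; rw [Perm.inv_eq_iff_eq, hφ]
  rw [mul_assoc, mul_assoc, swap_apply_apply, this, mul_assoc φ, ← mul_assoc φ φ]
  have : φ * φ = 1 := by ext d; simp [hφ d]
  rw [this, one_mul]

end Equiv.Perm

end

/-! ### Euler's formula -/

section

open Equiv

namespace Equiv.Perm

/-- The permutation exchanging the ends of every edge. -/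
def flip (E : Type*) : Perm (E × Bool) := Equiv.prodCongr (Equiv.refl E) Equiv.boolNot

@[simp]
theorem flip_apply {E : Type*} (d : E × Bool) : flip E d = (d.1, !d.2) := rfl

theorem flip_involutive (E : Type*) : Function.Involutive (flip E) := fun d => by simp

/-- The permutation exchanging the ends of the edges in `s`. -/
def flipOn {E : Type*} [DecidableEq E] (s : Finset E) : Perm (E × Bool) :=
  Function.Involutive.toPerm (fun d => if d.1 ∈ s then (d.1, !d.2) else d) fun d => by
    by_cases h : d.1 ∈ s <;> simp [h]

theorem flipOn_apply {E : Type*} [DecidableEq E] (s : Finset E) (d : E × Bool) :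
    flipOn s d = if d.1 ∈ s then (d.1, !d.2) else d := rfl

theorem flipOn_insert {E : Type*} [DecidableEq E] {s : Finset E} {e : E} (h : e ∉ s) :
    flipOn (insert e s) = flipOn s * swap (e, false) (e, true) := by
  ext1 ⟨a, t⟩
  rw [Perm.mul_apply]
  by_cases hae : a = e
  · subst hae
    cases t <;> simp [flipOn_apply, h]
  · rw [swap_apply_of_ne_of_ne (by simp [hae]) (by simp [hae])]
    simp [flipOn_apply, hae]

/-- The equivalence relation on the vertices generated by adjacency along the edges in `s`. -/
def connSetoid {E V : Type*} (b : E × Bool → V) (s : Set E) : Setoid V :=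
  Relation.EqvGen.setoid fun x y => ∃ e ∈ s, b (e, false) = x ∧ b (e, true) = y

theorem connSetoid_base {E V : Type*} {b : E × Bool → V} {s : Set E} {e : E} (he : e ∈ s)
    (t t' : Bool) : connSetoid b s (b (e, t)) (b (e, t')) := by
  have h : connSetoid b s (b (e, false)) (b (e, true)) := Relation.EqvGen.rel _ _ ⟨e, he, rfl, rfl⟩
  cases t <;> cases t'
  · exact (connSetoid b s).refl _
  · exact h
  · exact (connSetoid b s).symm h
  · exact (connSetoid b s).refl _

theorem connSetoid_le_iff {E V : Type*} {b : E × Bool → V} {s : Set E} {r : Setoid V} :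
    connSetoid b s ≤ r ↔ ∀ e ∈ s, r (b (e, false)) (b (e, true)) := by
  refine ⟨fun h e he => h (connSetoid_base he _ _), fun h => Setoid.eqvGen_le ?_⟩
  rintro _ _ ⟨e, he, rfl, rfl⟩
  exact h e he

theorem connSetoid_insert {E V : Type*} (b : E × Bool → V) (s : Set E) (e : E) :
    connSetoid b (insert e s) = (connSetoid b s).glue (b (e, false)) (b (e, true)) := by
  refine le_antisymm (connSetoid_le_iff.2 ?_) (Setoid.glue_le (connSetoid_le_iff.2 ?_) ?_)
  · rintro e' (rfl | he')
    · exact Setoid.glue_self _ _ _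
    · exact Setoid.le_glue _ _ _ (connSetoid_base he' _ _)
  · exact fun e' he' => connSetoid_base (Set.mem_insert_of_mem _ he') _ _
  · exact connSetoid_base (Set.mem_insert _ _) _ _

theorem IsRotation.numCycles_add {D V : Type*} [Finite V] {b : D → V} {ρ : Perm D}
    (h : IsRotation b ρ) : ρ.numCycles + Nat.card {v // v ∉ Set.range b} = Nat.card V := by
  classical
  rw [numCycles, h.setoid_eq, Nat.card_congr (Setoid.quotientKerEquivRange b), ← Nat.card_sum]
  exact Nat.card_congr (Equiv.sumCompl fun v => v ∈ Set.range b)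

/-- Euler's formula: the genus of a rotation system is a natural number. -/
theorem IsRotation.exists_genus {E V : Type*} [Finite E] [Finite V] {b : E × Bool → V}
    {ρ : Perm (E × Bool)} (h : IsRotation b ρ) :
    ∃ k, Nat.card V + ((ρ * flip E).numCycles + Nat.card {v // v ∉ Set.range b}) + 2 * k =
      Nat.card E + 2 * Nat.card (Quotient (connSetoid b _root_.Set.univ)) := by
  classical
  have := Fintype.ofFinite E
  -- Edges are closed up one at a time. For `s = ∅` the cycles of `ρ * flipOn s` are those of `ρ`,
  -- one for each vertex carrying a dart, and the genus is 0.
  suffices key : ∀ s : Finset E, ∃ k,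
      Nat.card V + ((ρ * flipOn s).numCycles + Nat.card {v // v ∉ Set.range b}) + 2 * k =
        s.card + 2 * Nat.card (Quotient (connSetoid b s)) by
    have h1 : flipOn (Finset.univ : Finset E) = flip E := by ext1 d; simp [flipOn_apply]
    simpa [h1] using key Finset.univ
  intro s
  induction s using Finset.induction_on with
  | empty =>
    refine ⟨0, ?_⟩
    have h1 : flipOn (∅ : Finset E) = 1 := by ext1 d; simp [flipOn_apply]
    have h2 : connSetoid b ((∅ : Finset E) : Set E) = ⊥ := by
      rw [eq_bot_iff, connSetoid_le_iff]; simp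
    rw [h1, h2, mul_one, h.numCycles_add, Nat.card_congr (Setoid.quotientBotEquiv)]
    simp; omega
  | insert e s he ih =>
    obtain ⟨k, hk⟩ := ih
    rw [flipOn_insert he, ← mul_assoc, Finset.card_insert_of_notMem he, Finset.coe_insert,
      connSetoid_insert]
    have hsub : ∀ d d', (ρ * flipOn s).SameCycle d d' → connSetoid b s (b d) (b d') := by
      have : SameCycle.setoid (ρ * flipOn s) ≤ (connSetoid b s).comap b := by
        rw [setoid_le_iff]
        rintro ⟨a, t⟩
        rw [Setoid.comap_rel, Perm.mul_apply, h.base_apply, flipOn_apply]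
        split_ifs with ha
        · exact connSetoid_base ha _ _
        · exact (connSetoid b s).refl _
      exact fun d d' hd => this hd
    -- Either the edge splits a face, inside one component; or it joins two faces, and then it adds
    -- a handle if its ends were already connected and merges two components otherwise.
    by_cases h1 : (ρ * flipOn s).SameCycle (e, false) (e, true)
    · refine ⟨k, ?_⟩
      rw [Setoid.glue_eq_self (hsub _ _ h1), numCycles_mul_swap (by simp) h1]
      omega
    · have h2 := numCycles_mul_swap_of_not h1
      by_cases h3 : connSetoid b s (b (e, false)) (b (e, true))
      · refine ⟨k + 1, ?_⟩
        rw [Setoid.glue_eq_self h3]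
        omega
      · have h4 := Setoid.card_quotient_glue h3
        exact ⟨k, by omega⟩

end Equiv.Perm

end

/-! ### Rotation systems of `H₃` -/

section

open Equiv Equiv.Perm

/-- The vertices of `K_{2,3}` as a sum type. -/
def H3Inner.equivSum : H3Inner ≃ Fin 3 ⊕ Bool where
  toFun | .mid j => .inl j | .hub b => .inr b
  invFun := Sum.elim .mid .hub
  left_inv v := by cases v <;> rfl
  right_inv v := by cases v <;> rfl

/-- The edges of `H₃` as a sum type. -/
def H3Edge.equivSum : H3Edge ≃ Fin 3 ⊕ Fin 3 × Bool where
  toFun | .free j => .inl j | .core j b => .inr (j, b)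
  invFun := Sum.elim .free fun p => .core p.1 p.2
  left_inv v := by cases v <;> rfl
  right_inv v := by cases v <;> rfl

instance : DecidableEq H3Inner := H3Inner.equivSum.decidableEq
instance : DecidableEq H3Edge := H3Edge.equivSum.decidableEq
instance : Fintype H3Inner := Fintype.ofEquiv _ H3Inner.equivSum.symm
instance : Fintype H3Edge := Fintype.ofEquiv _ H3Edge.equivSum.symm

namespace H3Edge

/-- The base points of the darts of `H₃`. -/
def base : H3Edge × Bool → Fin 3 ⊕ H3Inner
  | (.free j, false) => .inl j
  | (.free j, true) => .inr (.mid j)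
  | (.core j _, false) => .inr (.mid j)
  | (.core _ b, true) => .inr (.hub b)

theorem base_eq_inl_iff (d : H3Edge × Bool) (i : Fin 3) :
    base d = .inl i ↔ d = (.free i, false) := by
  rcases d with ⟨_ | _, _ | _⟩ <;> simp [base]

theorem base_eq_mid_iff (d : H3Edge × Bool) (i : Fin 3) :
    base d = .inr (.mid i) ↔ d = (.free i, true) ∨ ∃ b, d = (.core i b, false) := by
  rcases d with ⟨_ | _, _ | _⟩ <;> simp [base]

theorem base_eq_hub_iff (d : H3Edge × Bool) (b : Bool) :
    base d = .inr (.hub b) ↔ ∃ j, d = (.core j b, true) := by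
  rcases d with ⟨_ | _, _ | _⟩ <;> simp [base]

theorem base_surjective : Function.Surjective base := by
  rintro (i | i | b)
  · exact ⟨(.free i, false), rfl⟩
  · exact ⟨(.free i, true), rfl⟩
  · exact ⟨(.core 0 b, true), rfl⟩

theorem connSetoid_base_univ : connSetoid base _root_.Set.univ = ⊤ := by
  rw [eq_top_iff]
  set r := connSetoid base _root_.Set.univ
  have hr : ∀ e, r (base (e, false)) (base (e, true)) := fun e => connSetoid_base (_root_.Set.mem_univ e) _ _
  have hmid : ∀ j, r (.inr (.hub false)) (.inr (.mid j)) := fun j => r.symm (hr (.core j false))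
  have hall : ∀ v, r (.inr (.hub false)) v := by
    rintro (i | i | b)
    · exact r.trans (hmid i) (r.symm (hr (.free i)))
    · exact hmid i
    · exact r.trans (hmid 0) (hr (.core 0 b))
  exact fun v w _ => r.trans (r.symm (hall v)) (hall w)

/-- `H₃` is connected with 8 vertices, none isolated, and 9 edges, so Euler's formula leaves `3 -
2k` faces. -/
theorem numCycles_eq {ρ : Perm (H3Edge × Bool)} (h : IsRotation base ρ) :
    (ρ * flip H3Edge).numCycles = 1 ∨ (ρ * flip H3Edge).numCycles = 3 := by
  obtain ⟨k, hk⟩ := h.exists_genus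
  have h1 : Nat.card {v // v ∉ Set.range base} = 0 := by
    rw [Nat.card_eq_zero]
    exact Or.inl ⟨fun v => v.2 (base_surjective v.1)⟩
  have h2 : Nat.card (Quotient (connSetoid base _root_.Set.univ)) = 1 := by
    rw [connSetoid_base_univ, Nat.card_eq_one_iff_unique]
    exact ⟨⟨fun a b => Quotient.inductionOn₂ a b fun _ _ => Quotient.sound trivial⟩,
      ⟨Quotient.mk _ (.inl 0)⟩⟩
  have h3 : Nat.card H3Edge = 9 := by rw [Nat.card_eq_fintype_card]; rfl
  have h4 : Nat.card (Fin 3 ⊕ H3Inner) = 8 := by rw [Nat.card_eq_fintype_card]; rfl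
  have h5 : (ρ * flip H3Edge).numCycles ≠ 0 := by
    unfold numCycles
    rw [Nat.card_ne_zero]
    exact ⟨⟨Quotient.mk _ (.free 0, false)⟩, inferInstance⟩
  omega

/-- A planar rotation system of `H₃` does not have all free nodes on one face. -/
theorem exists_not_sameCycle {ρ : Perm (H3Edge × Bool)} (h : IsRotation base ρ)
    (h3 : (ρ * flip H3Edge).numCycles = 3) :
    ∃ i j, ¬ (ρ * flip H3Edge).SameCycle (.free i, true) (.free j, true) := by
  -- Suppose one face contains all three `y j`. It then leaves out at most one dart `w j` at each
  -- 2-valent vertex of `K_{2,3}`. Each of the other two faces contains at least two of the three `w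
  -- j`, which is impossible for disjoint faces.
  by_contra! hall
  set F := ρ * flip H3Edge with hF
  set y : Fin 3 → H3Edge × Bool := fun j => (.free j, true) with hy
  have happ : ∀ d, F d = ρ (d.1, !d.2) := fun d => rfl
  have hbase : ∀ d, base (F d) = base (d.1, !d.2) := fun d => h.base_apply _
  have hnext : ∀ d, F.SameCycle d (F d) := fun d => sameCycle_apply_right.2 (SameCycle.refl _ _)
  have hmove : ∀ d d', d ≠ d' → base d = base d' → ρ d ≠ d := fun d d' hne hb hfix =>
    hne (((h d d').2 hb).eq_of_left hfix)
  -- After `y j` the face turns back at the free node and leaves `mid j` along a core edge, which is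
  -- `z j`.
  have hz : ∀ j, ∃ b, F.SameCycle (y 0) (.core j b, false) := by
    intro j
    have h1 : F (y j) = (.free j, false) := (base_eq_inl_iff _ _).1 (hbase _)
    have h2 : F (F (y j)) ≠ y j := by
      rw [h1]; exact hmove _ (.core j false, false) (by simp) rfl
    have h4 : base (F (F (y j))) = .inr (.mid j) := by rw [h1]; exact hbase _
    obtain ⟨b, hb⟩ := ((base_eq_mid_iff _ _).1 h4).resolve_left h2
    refine ⟨b, ?_⟩
    rw [← hb]
    exact ((hall 0 j).trans (hnext _)).trans (hnext _)
  choose z hz using hz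
  set w : Fin 3 → H3Edge × Bool := fun j => (.core j (!(z j)), false) with hw
  have hA : ∀ d j, base d = .inr (.mid j) → F.SameCycle (y 0) d ∨ d = w j := by
    intro d j hd
    rcases (base_eq_mid_iff _ _).1 hd with rfl | ⟨b, rfl⟩
    · exact Or.inl (hall 0 j)
    · rcases eq_or_ne b (z j) with rfl | hb
      · exact Or.inl (hz j)
      · right
        have : b = !(z j) := by cases b <;> cases hzj : z j <;> simp_all
        rw [this]
  have hB : ∀ d, ¬ F.SameCycle (y 0) d → ∃ j, F.SameCycle d (w j) := by
    intro d hd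
    have hex : ∃ d' j, F.SameCycle d d' ∧ base d' = .inr (.mid j) := by
      rcases d with ⟨j | ⟨j, b⟩, _ | _⟩
      · exact ⟨_, j, hnext _, hbase _⟩
      · exact ⟨_, j, SameCycle.refl _ _, rfl⟩
      · exact ⟨_, j, SameCycle.refl _ _, rfl⟩
      · exact ⟨_, j, hnext _, hbase _⟩
    obtain ⟨d', j, hs, hb⟩ := hex
    rcases hA d' j hb with h1 | rfl
    · exact absurd (h1.trans hs.symm) hd
    · exact ⟨j, hs⟩
  -- From `w j` a face crosses to a hub, turns to a different core edge and reaches another `mid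
  -- j'`; off the face of `y 0`, its next dart can only be `w j'`.
  have hC : ∀ j, ¬ F.SameCycle (y 0) (w j) → ∃ j', j' ≠ j ∧ F.SameCycle (w j) (w j') := by
    intro j hj
    obtain ⟨j', hj'⟩ := (base_eq_hub_iff (F (w j)) (!(z j))).1 (hbase _)
    have hne : j' ≠ j := by
      rintro rfl
      refine hmove (.core j' (!(z j')), true) (.core (j' + 1) (!(z j')), true) ?_ rfl hj'
      simp
    have hs : F.SameCycle (w j) (F (F (w j))) := (hnext _).trans (hnext _)
    have hb : base (F (F (w j))) = .inr (.mid j') := by rw [hj']; exact hbase _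
    rcases hA _ _ hb with h1 | h1
    · exact absurd (h1.trans hs.symm) hj
    · exact ⟨j', hne, h1 ▸ hs⟩
  have hD : ∀ d, ¬ F.SameCycle (y 0) d →
      ∃ j j', j ≠ j' ∧ F.SameCycle d (w j) ∧ F.SameCycle d (w j') := by
    intro d hd
    obtain ⟨j, hj⟩ := hB d hd
    obtain ⟨j', hne, hj'⟩ := hC j fun h1 => hd (h1.trans hj.symm)
    exact ⟨j, j', hne.symm, hj, hj.trans hj'⟩
  obtain ⟨d₁, d₂, h01, h02, h12⟩ : ∃ d₁ d₂, ¬ F.SameCycle (y 0) d₁ ∧ ¬ F.SameCycle (y 0) d₂ ∧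
      ¬ F.SameCycle d₁ d₂ := by
    have e : Quotient (SameCycle.setoid F) ≃ Fin 3 := Finite.equivFinOfCardEq h3
    obtain ⟨a, b, ha, hb, hab⟩ : ∃ a b : Fin 3, e (Quotient.mk _ (y 0)) ≠ a ∧
        e (Quotient.mk _ (y 0)) ≠ b ∧ a ≠ b := by
      generalize e (Quotient.mk _ (y 0)) = c
      exact ⟨c + 1, c + 2, by simp, by simp, by simp⟩
    obtain ⟨d₁, hd₁⟩ := Quotient.exists_rep (e.symm a)
    obtain ⟨d₂, hd₂⟩ := Quotient.exists_rep (e.symm b)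
    rw [Equiv.eq_symm_apply] at hd₁ hd₂
    subst hd₁ hd₂
    refine ⟨d₁, d₂, fun h => ha ?_, fun h => hb ?_, fun h => hab ?_⟩ <;>
      exact congrArg e (Quotient.sound h)
  obtain ⟨a, b, hab, ha, hb⟩ := hD d₁ h01
  obtain ⟨c, d, hcd, hc, hd⟩ := hD d₂ h02
  have key : ∀ p q, F.SameCycle d₁ (w p) → F.SameCycle d₂ (w q) → p ≠ q := by
    rintro p q hp hq rfl
    exact h12 (hp.trans hq.symm)
  have := key a c ha hc
  have := key a d ha hd
  have := key b c hb hc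
  have := key b d hb hd
  omega

/-- The successor function of a planar rotation system of `H₃`. -/
def planarRotFun (c : Fin 3) : H3Edge × Bool → H3Edge × Bool
  | (.free j, false) => (.free j, false)
  | (.free j, true) => (.core j (decide (j = c + 2)), false)
  | (.core j b, false) =>
    if b = decide (j = c + 2) then (.core j !b, false) else (.free j, true)
  | (.core j b, true) => (.core (if b then j - 1 else j + 1) b, true)

/-- The vertices of `H₃` have valence 1 or 3, so the square of the successor map is its inverse. -/
theorem planarRotFun_pow_three : ∀ c d,
    planarRotFun c (planarRotFun c (planarRotFun c d)) = d := by
  decide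

/-- A planar rotation system of `H₃` with two given free nodes on a common face. -/
def planarRot (c : Fin 3) : Perm (H3Edge × Bool) where
  toFun := planarRotFun c
  invFun d := planarRotFun c (planarRotFun c d)
  left_inv := planarRotFun_pow_three c
  right_inv := planarRotFun_pow_three c

theorem base_planarRotFun : ∀ c d, base (planarRotFun c d) = base d := by decide

theorem eq_planarRotFun : ∀ c d d', base d = base d' →
    d' = d ∨ d' = planarRotFun c d ∨ d' = planarRotFun c (planarRotFun c d) := by
  decide

theorem isRotation_planarRot (c : Fin 3) : IsRotation base (planarRot c) := by
  intro d d'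
  constructor
  · have : SameCycle.setoid (planarRot c) ≤ Setoid.ker base :=
      setoid_le_iff.2 fun d => (base_planarRotFun c d).symm
    exact fun h => this h
  · intro h
    have h1 : ∀ d, (planarRot c).SameCycle d (planarRotFun c d) := fun d => ⟨1, by simp [planarRot]⟩
    rcases eq_planarRotFun c d d' h with rfl | rfl | rfl
    · exact SameCycle.refl _ _
    · exact h1 _
    · exact (h1 _).trans (h1 _)

/-- The face containing a dart in the planar rotation system `planarRot c`. -/
def planarFace (c : Fin 3) : H3Edge × Bool → Fin 3
  | (.free j, _) => if j = c + 2 then j - 1 else j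
  | (.core j b, false) => if b then j - 1 else j
  | (.core j b, true) => if b then j else j - 1

/-- Face `j` is the quadrilateral of `K_{2,3}` through `mid j` and `mid (j + 1)`. Free edge `j` is
drawn in face `j`, except that free edge `c + 2` is moved into face `c + 1`, next to free edge `c +
1`. -/
theorem planarFace_apply : ∀ c d,
    planarFace c (planarRotFun c (flip H3Edge d)) = planarFace c d := by decide

theorem three_le_numCycles_planarRot (c : Fin 3) :
    3 ≤ (planarRot c * flip H3Edge).numCycles := by
  have hle : SameCycle.setoid (planarRot c * flip H3Edge) ≤ Setoid.ker (planarFace c) :=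
    setoid_le_iff.2 fun d => (planarFace_apply c d).symm
  have := Nat.card_le_card_of_surjective
    (fun q : Quotient (SameCycle.setoid (planarRot c * flip H3Edge)) =>
      Quotient.lift (planarFace c) (fun a b h => hle h) q)
    (fun j => ⟨Quotient.mk _ (.core j false, false), rfl⟩)
  simpa [numCycles] using this

theorem sameCycle_planarRot (c : Fin 3) :
    (planarRot c * flip H3Edge).SameCycle (.free (c + 1), true) (.free (c + 2), true) := by
  have : ∀ c, planarRotFun c (flip H3Edge (planarRotFun c (flip H3Edge (planarRotFun c
    (flip H3Edge (planarRotFun c (flip H3Edge (.free (c + 1), true)))))))) =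
      (.free (c + 2), true) := by decide
  -- The four steps lead to the free node, back to `mid (c + 1)`, on to `hub false`, and to `mid (c
  -- + 2)`.
  exact ⟨4, this c⟩

end H3Edge

end

/-! ### One triple: exchanging a copy of `H₃` for a chord -/

section

open Equiv Equiv.Perm

namespace Equiv.Perm

theorem swap_mul_swap_of_ne {D : Type*} [DecidableEq D] {x y x' y' : D} (h1 : x ≠ x') (h2 : x ≠ y')
    (h3 : y ≠ x') (h4 : y ≠ y') : swap x y * swap x' y' = swap x' y' * swap x y := by
  rw [mul_swap_eq_swap_mul, swap_apply_of_ne_of_ne h1.symm h3.symm,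
    swap_apply_of_ne_of_ne h2.symm h4.symm]

/-- The three transpositions are disjoint and commute, so any two of them can be performed first. -/
theorem exists_swaps_eq {D D' : Type*} [DecidableEq D] [DecidableEq D'] {x : Fin 3 → D} {y : Fin 3 → D'} (hx : Function.Injective x)
    (hy : Function.Injective y) (σ : Perm (D ⊕ D')) {i j : Fin 3} (hij : i ≠ j) :
    ∃ k, σ * swap (Sum.inl (x 0)) (Sum.inr (y 0)) * swap (Sum.inl (x 1)) (Sum.inr (y 1)) *
      swap (Sum.inl (x 2)) (Sum.inr (y 2)) = σ * swap (Sum.inl (x i)) (Sum.inr (y i)) *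
        swap (Sum.inl (x j)) (Sum.inr (y j)) * swap (Sum.inl (x k)) (Sum.inr (y k)) := by
  set s : Fin 3 → Perm (D ⊕ D') := fun i => swap (Sum.inl (x i)) (Sum.inr (y i)) with hs
  have hc : ∀ i j, i ≠ j → s i * s j = s j * s i := fun i j hij =>
    swap_mul_swap_of_ne (by simpa using hx.ne hij) (by simp) (by simp) (by simpa using hy.ne hij)
  have h01 := hc 0 1 (by decide)
  have h02 := hc 0 2 (by decide)
  have h12 := hc 1 2 (by decide)
  change ∃ k, σ * s 0 * s 1 * s 2 = σ * s i * s j * s k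
  simp only [mul_assoc, mul_right_inj]
  fin_cases i <;> fin_cases j <;> simp only [Fin.zero_eta, Fin.mk_one, Fin.reduceFinMk, ne_eq,
    not_true_eq_false] at hij ⊢
  · exact ⟨2, rfl⟩
  · exact ⟨1, by rw [h12]⟩
  · exact ⟨2, by rw [← mul_assoc, h01, mul_assoc]⟩
  · exact ⟨0, by rw [← h02, ← mul_assoc, h01, mul_assoc]⟩
  · exact ⟨1, by rw [h12, ← mul_assoc, h02, mul_assoc]⟩
  · exact ⟨0, by rw [← h01, ← mul_assoc, ← mul_assoc, ← h02, mul_assoc, mul_assoc, h12]⟩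

section swaps

variable {D D' : Type*} [Finite D] [Finite D'] [DecidableEq D] [DecidableEq D']
  {F : Perm D} {K : Perm D'}

/-- After one identification the only cycle with darts on both sides is the union of the cycles of
`x` and `y`. This decides whether a second identification splits or joins. -/
theorem sameCycle_sumCongr_mul_swap_iff {x x' : D} {y y' : D'} :
    (Perm.sumCongr F K * swap (Sum.inl x) (Sum.inr y)).SameCycle (Sum.inl x') (Sum.inr y') ↔
      F.SameCycle x' x ∧ K.SameCycle y' y := by
  rw [← setoid_rel, setoid_mul_swap not_sameCycle_sumCongr, Setoid.glue_rel]
  simp only [setoid_rel, not_sameCycle_sumCongr, sameCycle_sumCongr_inl, sameCycle_sumCongr_inr,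
    false_and, or_false, false_or]

theorem numCycles_swap_swap_of_sameCycle {x x' : D} {y y' : D'} (hx : F.SameCycle x x')
    (hy : K.SameCycle y y') :
    (Perm.sumCongr F K * swap (Sum.inl x) (Sum.inr y) * swap (Sum.inl x') (Sum.inr y')).numCycles =
      F.numCycles + K.numCycles := by
  rw [numCycles_mul_swap Sum.inl_ne_inr (sameCycle_sumCongr_mul_swap_iff.2 ⟨hx.symm, hy.symm⟩),
    numCycles_mul_swap_of_not not_sameCycle_sumCongr, numCycles_sumCongr]

theorem numCycles_swap_swap_of_not {x x' : D} {y y' : D'}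
    (h : ¬ (F.SameCycle x x' ∧ K.SameCycle y y')) :
    (Perm.sumCongr F K * swap (Sum.inl x) (Sum.inr y) * swap (Sum.inl x') (Sum.inr y')).numCycles + 2 =
      F.numCycles + K.numCycles := by
  have h1 := numCycles_mul_swap_of_not (σ := Perm.sumCongr F K * swap (Sum.inl x) (Sum.inr y)) (x := .inl x')
    (y := .inr y') (fun h' => h ((sameCycle_sumCongr_mul_swap_iff.1 h').imp .symm .symm))
  have h2 := numCycles_mul_swap_of_not (σ := Perm.sumCongr F K)
    (not_sameCycle_sumCongr (a := x) (b := y))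
  rw [numCycles_sumCongr] at h2
  omega

theorem le_numCycles_swap_swap (x x' : D) (y y' : D') :
    F.numCycles + K.numCycles ≤
      (Perm.sumCongr F K * swap (Sum.inl x) (Sum.inr y) * swap (Sum.inl x') (Sum.inr y')).numCycles + 2 := by
  by_cases h : F.SameCycle x x' ∧ K.SameCycle y y'
  · rw [numCycles_swap_swap_of_sameCycle h.1 h.2]; omega
  · rw [numCycles_swap_swap_of_not h]

/-- Each identification brings in a face of `F` not touched before, so all three join cycles. -/
theorem numCycles_swap_swap_swap_of_not {x : Fin 3 → D} (y : Fin 3 → D')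
    (h : ∀ i j, i ≠ j → ¬ F.SameCycle (x i) (x j)) :
    (Perm.sumCongr F K * swap (Sum.inl (x 0)) (Sum.inr (y 0)) * swap (Sum.inl (x 1)) (Sum.inr (y 1)) *
      swap (Sum.inl (x 2)) (Sum.inr (y 2))).numCycles + 3 = F.numCycles + K.numCycles := by
  have h1 : ¬ (Perm.sumCongr F K * swap (Sum.inl (x 0)) (Sum.inr (y 0)) *
      swap (Sum.inl (x 1)) (Sum.inr (y 1))).SameCycle (Sum.inl (x 2)) (Sum.inr (y 2)) := by
    rw [← setoid_rel, setoid_mul_swap, Setoid.glue_rel, setoid_mul_swap not_sameCycle_sumCongr]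
    · simp only [Setoid.glue_rel, setoid_rel, not_sameCycle_sumCongr, sameCycle_sumCongr_inl,
        h 2 0 (by decide), h 2 1 (by decide), false_and, or_false, not_false_eq_true]
    · rw [sameCycle_sumCongr_mul_swap_iff]
      exact fun h' => h 1 0 (by decide) h'.1
  have h2 := numCycles_mul_swap_of_not h1
  have h3 := numCycles_swap_swap_of_not (F := F) (K := K) (x := x 0) (x' := x 1) (y := y 0)
    (y' := y 1) fun h' => h 0 1 (by decide) h'.1
  omega

/-- Perform the pair `i`, `j` first: it loses two cycles, and the third transposition regains at
most one. -/
theorem numCycles_swap_swap_swap_le {x : Fin 3 → D} {y : Fin 3 → D'} (hx : Function.Injective x)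
    (hy : Function.Injective y) {i j : Fin 3} (h : ¬ (F.SameCycle (x i) (x j) ∧
      K.SameCycle (y i) (y j))) :
    (Perm.sumCongr F K * swap (Sum.inl (x 0)) (Sum.inr (y 0)) * swap (Sum.inl (x 1)) (Sum.inr (y 1)) *
      swap (Sum.inl (x 2)) (Sum.inr (y 2))).numCycles + 1 ≤ F.numCycles + K.numCycles := by
  have hij : i ≠ j := by
    rintro rfl
    exact h ⟨SameCycle.refl _ _, SameCycle.refl _ _⟩
  obtain ⟨k, hk⟩ := exists_swaps_eq hx hy (Perm.sumCongr F K) hij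
  rw [hk]
  have h1 := numCycles_swap_swap_of_not h
  have h2 := numCycles_mul_swap_le (Perm.sumCongr F K * swap (Sum.inl (x i)) (Sum.inr (y i)) *
    swap (Sum.inl (x j)) (Sum.inr (y j))) (Sum.inl (x k)) (Sum.inr (y k))
  omega

end swaps

theorem glueBase_univ_inr {D D' V W ι : Type*} {b : D → V} {b' : D' → ι ⊕ W} {u : ι → V} (d : D') :
    glueBase b b' u _root_.Set.univ (Sum.inr d) = Sum.map u .inr (b' d) := by
  rcases h : b' d <;> simp [glueBase, h]

/-- The base points of the darts after adding an edge from `p` to `q`. -/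
def chordBase {D V : Type*} (b : D → V) (p q : V) : D ⊕ Bool → V :=
  Sum.elim b fun s => cond s q p

/-- A chord is a single edge with both end nodes identified, so the lemmas on `glueBase` apply to
chords as well as to `H₃`; `Empty` records that the edge has no other vertices. -/
theorem faceCounts_chordBase {D V : Type*} (φ : Perm D) (b : D → V) (u : Bool → V) :
    faceCounts (Perm.sumCongr φ boolNot) (glueBase b (Sum.inl : Bool → Bool ⊕ Empty) u
      _root_.Set.univ) = faceCounts (Perm.sumCongr φ boolNot) (chordBase b (u false) (u true)) := by
  have : ∀ d, glueBase b (Sum.inl : Bool → Bool ⊕ Empty) u _root_.Set.univ d =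
      .inl (chordBase b (u false) (u true) d) := by
    rintro (d | _ | _)
    · rfl
    · rw [glueBase_univ_inr]; rfl
    · rw [glueBase_univ_inr]; rfl
  exact faceCounts_congr (Equiv.refl _) (fun d => rfl) fun d d' => by
    simp only [Equiv.refl_apply, this, Sum.inl.injEq]

theorem numCycles_boolNot : numCycles boolNot = 1 := by
  have h : ∀ a b : Bool, boolNot.SameCycle a b := fun a b => by
    rcases eq_or_ne a b with rfl | hab
    · exact SameCycle.refl _ _
    · exact ⟨1, by cases a <;> cases b <;> simp_all [boolNot]⟩
  rw [numCycles, Nat.card_eq_one_iff_unique]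
  exact ⟨⟨fun a b => Quotient.inductionOn₂ a b fun _ _ => Quotient.sound (h _ _)⟩,
    ⟨Quotient.mk _ false⟩⟩

theorem sameCycle_boolNot : boolNot.SameCycle true false := ⟨1, by simp [boolNot]⟩

theorem mul_swap_eq_iff_eq_mul_swap {D : Type*} [DecidableEq D] {σ τ : Perm D} {x y : D} :
    σ * swap x y = τ ↔ σ = τ * swap x y := by
  rw [← eq_mul_inv_iff_mul_eq, swap_inv]

theorem sumCongr_involutive {D D' : Type*} {φ : Perm D} {φ' : Perm D'} (hφ : Function.Involutive φ)
    (hφ' : Function.Involutive φ') : Function.Involutive (Perm.sumCongr φ φ') := by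
  rintro (d | d)
  · simp [hφ d]
  · simp [hφ' d]

section step

variable {D V : Type*} [Finite D] {φ : Perm D} {b : D → V}

theorem IsRotation.attach_chord [DecidableEq D] {ρ : Perm D} (h : IsRotation b ρ)
    (hφ : Function.Involutive φ) {d d' : D} (hd : b d ≠ b d') :
    (Perm.sumCongr (ρ * φ) boolNot * swap (Sum.inl (φ d)) (Sum.inr true) *
      swap (Sum.inl (φ d')) (Sum.inr false)).numCycles ∈
        faceCounts (Perm.sumCongr φ boolNot) (chordBase b (b d) (b d')) := by
  have hu : Function.Injective fun s => cond s (b d') (b d) := by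
    rintro (_ | _) (_ | _) <;> simp [hd, hd.symm]
  have h1 : IsRotation (Sum.inl : Bool → Bool ⊕ Empty) 1 := fun s s' => by simp
  have hf : ∀ s i, (Sum.inl s : Bool ⊕ Empty) = .inl i ↔ s = i := fun s i => by simp
  have h2 := ((h.sumCongr (u := fun s => cond s (b d') (b d)) h1).attach (i := false) hf
    (by simp) (d := d) rfl).attach (i := true) hf (by simp) (d := d') rfl
  have hA : insert true (insert false (∅ : Set Bool)) = _root_.Set.univ := by
    ext s; cases s <;> simp
  rw [hA] at h2
  refine (faceCounts_chordBase φ b fun s => cond s (b d') (b d)) ▸ ⟨_, h2, ?_⟩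
  have hinv := sumCongr_involutive hφ (φ' := boolNot) Bool.not_not
  rw [mul_swap_mul_involutive hinv, mul_swap_mul_involutive hinv, sumCongr_mul]
  rfl

theorem IsRotation.detach_chord [DecidableEq D] {p q : V} (hpq : p ≠ q) (hφ : Function.Involutive φ)
    (hp : p ∈ _root_.Set.range b) (hq : q ∈ _root_.Set.range b) {N : ℕ}
    (hN : N ∈ faceCounts (Perm.sumCongr φ boolNot) (chordBase b p q)) :
    ∃ (ρ : Perm D) (d d' : D), IsRotation b ρ ∧ b d = p ∧ b d' = q ∧
      N = (Perm.sumCongr (ρ * φ) boolNot * swap (Sum.inl (φ d)) (Sum.inr true) *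
        swap (Sum.inl (φ d')) (Sum.inr false)).numCycles := by
  have hu : Function.Injective fun s => cond s q p := by
    rintro (_ | _) (_ | _) <;> simp [hpq, hpq.symm]
  have hf : ∀ s i, (Sum.inl s : Bool ⊕ Empty) = .inl i ↔ s = i := fun s i => by simp
  have hA : insert true (insert false (∅ : Set Bool)) = _root_.Set.univ := by
    ext s; cases s <;> simp
  obtain ⟨ρ, hρ, rfl⟩ := (faceCounts_chordBase φ b fun s => cond s q p).symm ▸ hN
  rw [← hA] at hρ
  obtain ⟨d', hd', h1⟩ := hρ.detach hf hu (by simp) hq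
  obtain ⟨d, hd, h2⟩ := h1.detach hf hu (by simp) hp
  obtain ⟨ρ₁, ρ₂, hρ₁, hρ₂, heq⟩ := h2.exists_sumCongr
  -- A single edge has one dart at each node, hence only the trivial rotation system.
  have hone : ρ₂ = 1 := by
    ext1 s
    exact Sum.inl_injective (hρ₂.base_apply s)
  subst hone
  rw [mul_swap_eq_iff_eq_mul_swap, mul_swap_eq_iff_eq_mul_swap] at heq
  refine ⟨ρ₁, d, d', hρ₁, hd, hd', ?_⟩
  have hinv := sumCongr_involutive hφ (φ' := boolNot) Bool.not_not
  rw [heq, mul_swap_mul_involutive hinv, mul_swap_mul_involutive hinv, sumCongr_mul]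
  rfl

/-- The base points of the darts after attaching a copy of `H₃` at `u`. -/
noncomputable abbrev scaffoldBase (b : D → V) (u : Fin 3 → V) :
    D ⊕ H3Edge × Bool → V ⊕ (Fin 3 ⊕ H3Inner) :=
  glueBase b H3Edge.base u _root_.Set.univ

theorem exists_chord_faceCount_of_scaffold {u : Fin 3 → V} (hφ : Function.Involutive φ)
    (hu : Function.Injective u) (hr : ∀ i, u i ∈ _root_.Set.range b) {N : ℕ}
    (hN : N ∈ faceCounts (Perm.sumCongr φ (flip H3Edge)) (scaffoldBase b u)) :
    ∃ c : Fin 3, ∃ N' ∈ faceCounts (Perm.sumCongr φ boolNot) (chordBase b (u (c + 1)) (u (c + 2))),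
      N ≤ N' + 1 := by
  classical
  obtain ⟨ρ, hρ, rfl⟩ := hN
  have hA : insert 2 (insert 1 (insert 0 (∅ : Set (Fin 3)))) = _root_.Set.univ := by
    ext s; fin_cases s <;> simp
  rw [scaffoldBase, ← hA] at hρ
  have hf := H3Edge.base_eq_inl_iff
  obtain ⟨d₂, hd₂, h2⟩ := hρ.detach hf hu (by simp) (hr _)
  obtain ⟨d₁, hd₁, h1⟩ := h2.detach hf hu (by simp) (hr _)
  obtain ⟨d₀, hd₀, h0⟩ := h1.detach hf hu (by simp) (hr _)
  obtain ⟨ρ₁, ρ₂, hρ₁, hρ₂, heq⟩ := h0.exists_sumCongr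
  rw [mul_swap_eq_iff_eq_mul_swap, mul_swap_eq_iff_eq_mul_swap, mul_swap_eq_iff_eq_mul_swap] at heq
  have hinv := sumCongr_involutive hφ (flip_involutive H3Edge)
  rw [heq, mul_swap_mul_involutive hinv, mul_swap_mul_involutive hinv,
    mul_swap_mul_involutive hinv, sumCongr_mul]
  set F := ρ₁ * φ
  set K := ρ₂ * flip H3Edge with hK
  set d : Fin 3 → D := ![d₀, d₁, d₂] with hd
  have hdu : ∀ i, b (d i) = u i := by
    intro i; fin_cases i
    · exact hd₀
    · exact hd₁
    · exact hd₂
  set x : Fin 3 → D := fun i => φ (d i) with hx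
  set y : Fin 3 → H3Edge × Bool := fun i => (.free i, true) with hy
  change ∃ c : Fin 3, ∃ N' ∈ _, (Perm.sumCongr F K * swap (Sum.inl (x 0)) (Sum.inr (y 0)) *
    swap (Sum.inl (x 1)) (Sum.inr (y 1)) * swap (Sum.inl (x 2)) (Sum.inr (y 2))).numCycles ≤ N' + 1
  have hxi : Function.Injective x := fun i j hij => hu <| by
    rw [← hdu, ← hdu, φ.injective hij]
  have hyi : Function.Injective y := fun i j hij => by simpa [hy] using hij
  have hchord : ∀ c : Fin 3, (Perm.sumCongr F boolNot * swap (Sum.inl (x (c + 1))) (Sum.inr true) *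
      swap (Sum.inl (x (c + 2))) (Sum.inr false)).numCycles ∈
        faceCounts (Perm.sumCongr φ boolNot) (chordBase b (u (c + 1)) (u (c + 2))) := by
    intro c
    have := hρ₁.attach_chord hφ (d := d (c + 1)) (d' := d (c + 2))
      (by rw [hdu, hdu]; exact hu.ne (by simp))
    rwa [hdu, hdu] at this
  have hK3 := H3Edge.numCycles_eq hρ₂
  rw [← hK] at hK3
  -- If two corners share a face of `F`, the chord is drawn there and splits it.
  by_cases hsame : ∃ i j, i ≠ j ∧ F.SameCycle (x i) (x j)
  · obtain ⟨c, hc⟩ : ∃ c : Fin 3, F.SameCycle (x (c + 1)) (x (c + 2)) := by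
      obtain ⟨i, j, hij, hs⟩ := hsame
      have : ∀ i j : Fin 3, i ≠ j → ∃ c : Fin 3, (i = c + 1 ∧ j = c + 2) ∨ (j = c + 1 ∧ i = c + 2) := by
        decide
      obtain ⟨c, ⟨rfl, rfl⟩ | ⟨rfl, rfl⟩⟩ := this i j hij
      · exact ⟨c, hs⟩
      · exact ⟨c, hs.symm⟩
    refine ⟨c, _, hchord c, ?_⟩
    rw [numCycles_swap_swap_of_sameCycle hc sameCycle_boolNot, numCycles_boolNot]
    by_cases hall : ∃ i j, ¬ (F.SameCycle (x i) (x j) ∧ K.SameCycle (y i) (y j))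
    · obtain ⟨i, j, hij⟩ := hall
      have := numCycles_swap_swap_swap_le hxi hyi hij
      omega
    -- All corners are cofacial on both sides, so `K` is not planar and has one cycle: the first
    -- identification joins and the other two add at most one face each.
    · push Not at hall
      have hK1 : K.numCycles = 1 := by
        refine hK3.resolve_right fun h3 => ?_
        obtain ⟨i, j, hij⟩ := H3Edge.exists_not_sameCycle hρ₂ h3
        exact hij (hall i j).2
      have h1 := numCycles_mul_swap_of_not (σ := Perm.sumCongr F K)
        (not_sameCycle_sumCongr (a := x 0) (b := y 0))
      rw [numCycles_sumCongr] at h1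
      have h2 := numCycles_mul_swap_le (Perm.sumCongr F K * swap (Sum.inl (x 0)) (Sum.inr (y 0)))
        (Sum.inl (x 1)) (Sum.inr (y 1))
      have h3 := numCycles_mul_swap_le (Perm.sumCongr F K * swap (Sum.inl (x 0)) (Sum.inr (y 0)) *
        swap (Sum.inl (x 1)) (Sum.inr (y 1))) (Sum.inl (x 2)) (Sum.inr (y 2))
      omega
  · push Not at hsame
    refine ⟨0, _, hchord 0, ?_⟩
    have h1 := numCycles_swap_swap_swap_of_not (K := K) y hsame
    have h2 := le_numCycles_swap_swap (F := F) (K := boolNot) (x (0 + 1)) (x (0 + 2)) true false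
    rw [numCycles_boolNot] at h2
    omega

theorem exists_scaffold_faceCount_of_chord {u : Fin 3 → V} (hφ : Function.Involutive φ)
    (hu : Function.Injective u) (hr : ∀ i, u i ∈ _root_.Set.range b) {N : ℕ} {c : Fin 3}
    (hN : N ∈ faceCounts (Perm.sumCongr φ boolNot) (chordBase b (u (c + 1)) (u (c + 2)))) :
    ∃ N' ∈ faceCounts (Perm.sumCongr φ (flip H3Edge)) (scaffoldBase b u), N + 1 ≤ N' := by
  classical
  obtain ⟨ρ, d₁, d₂, hρ, hd₁, hd₂, rfl⟩ :=
    IsRotation.detach_chord (hu.ne (by simp)) hφ (hr _) (hr _) hN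
  obtain ⟨d₀, hd₀⟩ := hr c
  have hf := H3Edge.base_eq_inl_iff
  have hK := H3Edge.isRotation_planarRot c
  have hA : insert c (insert (c + 2) (insert (c + 1) (∅ : Set (Fin 3)))) = _root_.Set.univ := by
    ext s; fin_cases c <;> fin_cases s <;> simp
  have h2 := (((hρ.sumCongr (u := u) hK).attach (i := c + 1) hf (by simp) hd₁).attach
    (i := c + 2) hf (by simp) hd₂).attach (i := c) hf (by simp) hd₀
  rw [hA] at h2
  refine ⟨_, ⟨_, h2, rfl⟩, ?_⟩
  have hinv := sumCongr_involutive hφ (flip_involutive H3Edge)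
  rw [mul_swap_mul_involutive hinv, mul_swap_mul_involutive hinv,
    mul_swap_mul_involutive hinv, sumCongr_mul]
  -- The third identification, at an arbitrary dart of `u c`, costs at most one face. The first two
  -- act as those of the chord do, but with at least three cycles of `K` in place of one.
  refine Nat.le_of_add_le_add_right (Nat.le_trans ?_ (le_numCycles_mul_swap _ _ _))
  simp only [sumCongr_apply, Sum.map_inl, Sum.map_inr, flip_apply, Bool.not_false]
  have h3 := H3Edge.three_le_numCycles_planarRot c
  by_cases hs : (ρ * φ).SameCycle (φ d₁) (φ d₂)
  · rw [numCycles_swap_swap_of_sameCycle hs sameCycle_boolNot,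
      numCycles_swap_swap_of_sameCycle hs (H3Edge.sameCycle_planarRot c), numCycles_boolNot]
    omega
  · have h4 := numCycles_swap_swap_of_not (F := ρ * φ) (K := boolNot) (x := φ d₁) (x' := φ d₂)
      (y := true) (y' := false) fun h => hs h.1
    have h5 := numCycles_swap_swap_of_not (F := ρ * φ) (K := H3Edge.planarRot c * flip H3Edge)
      (x := φ d₁) (x' := φ d₂) (y := (.free (c + 1), true)) (y' := (.free (c + 2), true))
      fun h => hs h.1
    rw [numCycles_boolNot] at h4
    omega

end step

end Equiv.Perm

end

/-! ### All triples, by induction on their number -/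

section

open Equiv Equiv.Perm

/-- Split off the first summand of a family of copies of `B` indexed by `Fin (n + 1)`. -/
def Equiv.sumFinSuccProd (A B : Type*) (n : ℕ) : A ⊕ Fin (n + 1) × B ≃ (A ⊕ Fin n × B) ⊕ B where
  toFun := Sum.elim (fun a => .inl (.inl a)) fun p =>
    Fin.cases (.inr p.2) (fun i => .inl (.inr (i, p.2))) p.1
  invFun := Sum.elim (Sum.elim .inl fun p => .inr (p.1.succ, p.2)) fun b => .inr (0, b)
  left_inv := by
    rintro (a | ⟨i, b⟩)
    · rfl
    · cases i using Fin.cases <;> rfl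
  right_inv := by rintro ((a | p) | b) <;> rfl

/-- Exchange the last two summands. -/
def Equiv.sumRightComm (A B C : Type*) : (A ⊕ B) ⊕ C ≃ (A ⊕ C) ⊕ B where
  toFun := Sum.elim (Sum.elim (fun a => .inl (.inl a)) .inr) fun c => .inl (.inr c)
  invFun := Sum.elim (Sum.elim (fun a => .inl (.inl a)) .inr) fun c => .inl (.inr c)
  left_inv := by rintro ((a | p) | b) <;> rfl
  right_inv := by rintro ((a | p) | b) <;> rfl

namespace Equiv.Perm

/-- The permutation that acts on each of `n` copies by `φ`. -/
abbrev copies (n : ℕ) {D : Type*} (φ : Perm D) : Perm (Fin n × D) :=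
  Equiv.prodCongr (Equiv.refl (Fin n)) φ

theorem copies_involutive (n : ℕ) {D : Type*} {φ : Perm D} (h : Function.Involutive φ) :
    Function.Involutive (copies n φ) := fun d =>
  Prod.ext rfl (h d.2)

theorem faceCounts_congr_of_injective {D D' V V' : Type*} {φ : Perm D} {φ' : Perm D'} {b : D → V}
    {b' : D' → V'} (e : D ≃ D') {g : V → V'} (hg : Function.Injective g)
    (hφ : ∀ d, e (φ d) = φ' (e d)) (hb : ∀ d, b' (e d) = g (b d)) :
    faceCounts φ b = faceCounts φ' b' :=
  faceCounts_congr e hφ fun d d' => by rw [hb, hb, hg.eq_iff]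

/-- The base points of the darts after attaching a copy of `H₃` at each triple `t i`. -/
def scaffoldsBase {D V : Type*} (b : D → V) {n : ℕ} (t : Fin n → Fin 3 → V) :
    D ⊕ Fin n × (H3Edge × Bool) → V ⊕ Fin n × H3Inner :=
  Sum.elim (fun d => .inl (b d)) fun p => Sum.map (t p.1) (Prod.mk p.1) (H3Edge.base p.2)

/-- The base points of the darts after adding, for each `i`, an edge between the vertices of the
triple `t i` other than `t i (c i)`. -/
def chordsBase {D V : Type*} (b : D → V) {n : ℕ} (t : Fin n → Fin 3 → V) (c : Fin n → Fin 3) :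
    D ⊕ Fin n × Bool → V :=
  Sum.elim b fun p => cond p.2 (t p.1 (c p.1 + 2)) (t p.1 (c p.1 + 1))

variable {D V : Type*} (φ : Perm D) (b : D → V)

theorem faceCounts_scaffoldsBase_zero (t : Fin 0 → Fin 3 → V) :
    faceCounts (Perm.sumCongr φ (copies 0 (flip H3Edge))) (scaffoldsBase b t) = faceCounts φ b := by
  symm
  refine faceCounts_congr_of_injective (Equiv.sumEmpty D _).symm Sum.inl_injective ?_ ?_ <;>
    exact fun d => rfl

theorem faceCounts_chordsBase_zero (t : Fin 0 → Fin 3 → V) (c : Fin 0 → Fin 3) :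
    faceCounts (Perm.sumCongr φ (copies 0 boolNot)) (chordsBase b t c) = faceCounts φ b := by
  symm
  refine faceCounts_congr_of_injective (Equiv.sumEmpty D _).symm Function.injective_id ?_ ?_ <;>
    exact fun d => rfl

theorem faceCounts_scaffoldsBase_succ {n : ℕ} (t : Fin (n + 1) → Fin 3 → V) :
    faceCounts (Perm.sumCongr φ (copies (n + 1) (flip H3Edge))) (scaffoldsBase b t) =
      faceCounts (Perm.sumCongr (Perm.sumCongr φ (copies n (flip H3Edge))) (flip H3Edge))
        (scaffoldBase (scaffoldsBase b fun i => t i.succ) fun j => .inl (t 0 j)) := by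
  refine faceCounts_congr_of_injective (Equiv.sumFinSuccProd _ _ n)
    (g := Sum.map id Sum.inr ∘ Equiv.sumFinSuccProd V H3Inner n)
    ((Function.injective_id.sumMap Sum.inr_injective).comp (Equiv.injective _)) ?_ ?_
  · rintro (d | ⟨i, d⟩)
    · rfl
    · cases i using Fin.cases <;> rfl
  · rintro (d | ⟨i, d⟩)
    · rfl
    · cases i using Fin.cases with
      | zero =>
        change glueBase _ _ _ _ (Sum.inr d) = _
        rw [glueBase_univ_inr]
        simp only [scaffoldsBase, Sum.elim_inr]
        rcases H3Edge.base d <;> rfl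
      | succ i =>
        change Sum.inl (Sum.map (t i.succ) (Prod.mk i) (H3Edge.base d)) =
          Sum.map id Sum.inr (Equiv.sumFinSuccProd V H3Inner n
            (Sum.map (t i.succ) (Prod.mk i.succ) (H3Edge.base d)))
        rcases H3Edge.base d <;> rfl

/-- Adding the chord before or after the other copies of `H₃` gives the same graph; hence the
induction hypothesis can be applied to the graph with the chord. -/
theorem faceCounts_chordBase_scaffoldsBase {n : ℕ} (t : Fin n → Fin 3 → V) (p q : V) :
    faceCounts (Perm.sumCongr (Perm.sumCongr φ (copies n (flip H3Edge))) boolNot)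
        (chordBase (scaffoldsBase b t) (.inl p) (.inl q)) =
      faceCounts (Perm.sumCongr (Perm.sumCongr φ boolNot) (copies n (flip H3Edge)))
        (scaffoldsBase (chordBase b p q) t) := by
  refine faceCounts_congr_of_injective (Equiv.sumRightComm _ _ _) Function.injective_id ?_ ?_
  · rintro ((d | d) | d) <;> rfl
  · rintro ((d | d) | (_ | _)) <;> rfl

theorem faceCounts_chordsBase_succ {n : ℕ} (t : Fin (n + 1) → Fin 3 → V) (c : Fin 3)
    (c' : Fin n → Fin 3) :
    faceCounts (Perm.sumCongr φ (copies (n + 1) boolNot)) (chordsBase b t (Fin.cons c c')) =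
      faceCounts (Perm.sumCongr (Perm.sumCongr φ boolNot) (copies n boolNot))
        (chordsBase (chordBase b (t 0 (c + 1)) (t 0 (c + 2))) (fun i => t i.succ) c') := by
  refine faceCounts_congr_of_injective
    ((Equiv.sumFinSuccProd _ _ n).trans (Equiv.sumRightComm _ _ _)) Function.injective_id ?_ ?_
  · rintro (d | ⟨i, d⟩)
    · rfl
    · cases i using Fin.cases <;> rfl
  · rintro (d | ⟨i, d⟩)
    · rfl
    · cases i using Fin.cases <;> rfl

theorem injective_triple {n : ℕ} {t : Fin (n + 1) → Fin 3 → V}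
    (ht : Function.Injective fun q : Fin (n + 1) × Fin 3 => t q.1 q.2) (i : Fin (n + 1)) :
    Function.Injective (t i) := fun j k h => by
  simpa using @ht (i, j) (i, k) h

theorem injective_tail {n : ℕ} {t : Fin (n + 1) → Fin 3 → V}
    (ht : Function.Injective fun q : Fin (n + 1) × Fin 3 => t q.1 q.2) :
    Function.Injective fun q : Fin n × Fin 3 => t q.1.succ q.2 := fun p q h => by
  have := @ht (p.1.succ, p.2) (q.1.succ, q.2) h
  simpa [Prod.ext_iff] using this

variable {φ b}

theorem exists_chords_faceCount_of_scaffolds [Finite D] (hφ : Function.Involutive φ) {n : ℕ}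
    {t : Fin n → Fin 3 → V} (ht : Function.Injective fun q : Fin n × Fin 3 => t q.1 q.2)
    (hr : ∀ i j, t i j ∈ _root_.Set.range b) {N : ℕ}
    (hN : N ∈ faceCounts (Perm.sumCongr φ (copies n (flip H3Edge))) (scaffoldsBase b t)) :
    ∃ c, ∃ N' ∈ faceCounts (Perm.sumCongr φ (copies n boolNot)) (chordsBase b t c),
      N ≤ N' + n := by
  -- The darts must vary: the hypothesis is applied to the graph enlarged by a chord in the first
  -- triple.
  induction n generalizing D N with
  | zero =>
    rw [faceCounts_scaffoldsBase_zero] at hN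
    exact ⟨fun _ => 0, N, by rwa [faceCounts_chordsBase_zero], le_rfl⟩
  | succ n ih =>
    rw [faceCounts_scaffoldsBase_succ] at hN
    obtain ⟨c, N₁, hN₁, hle₁⟩ := exists_chord_faceCount_of_scaffold
      (sumCongr_involutive hφ (copies_involutive n (flip_involutive _)))
      (Sum.inl_injective.comp (injective_triple ht 0))
      (fun j => by
        obtain ⟨d, hd⟩ := hr 0 j
        exact ⟨.inl d, congrArg Sum.inl hd⟩) hN
    simp only [Function.comp_apply] at hN₁
    rw [faceCounts_chordBase_scaffoldsBase] at hN₁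
    obtain ⟨c', N₂, hN₂, hle₂⟩ := ih (sumCongr_involutive hφ (φ' := boolNot) Bool.not_not)
      (injective_tail ht) (fun i j => by
        obtain ⟨d, hd⟩ := hr i.succ j
        exact ⟨.inl d, hd⟩) hN₁
    refine ⟨Fin.cons c c', N₂, ?_, by omega⟩
    rwa [faceCounts_chordsBase_succ]

theorem exists_scaffolds_faceCount_of_chords [Finite D] (hφ : Function.Involutive φ) {n : ℕ}
    {t : Fin n → Fin 3 → V} (ht : Function.Injective fun q : Fin n × Fin 3 => t q.1 q.2)
    (hr : ∀ i j, t i j ∈ _root_.Set.range b) {c : Fin n → Fin 3} {N : ℕ}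
    (hN : N ∈ faceCounts (Perm.sumCongr φ (copies n boolNot)) (chordsBase b t c)) :
    ∃ N' ∈ faceCounts (Perm.sumCongr φ (copies n (flip H3Edge))) (scaffoldsBase b t),
      N + n ≤ N' := by
  induction n generalizing D N with
  | zero =>
    rw [faceCounts_chordsBase_zero] at hN
    exact ⟨N, by rwa [faceCounts_scaffoldsBase_zero], le_rfl⟩
  | succ n ih =>
    rw [← Fin.cons_self_tail c, faceCounts_chordsBase_succ] at hN
    obtain ⟨N₁, hN₁, hle₁⟩ := ih (sumCongr_involutive hφ (φ' := boolNot) Bool.not_not)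
      (injective_tail ht) (fun i j => by
        obtain ⟨d, hd⟩ := hr i.succ j
        exact ⟨.inl d, hd⟩) hN
    rw [← faceCounts_chordBase_scaffoldsBase] at hN₁
    obtain ⟨N₂, hN₂, hle₂⟩ := exists_scaffold_faceCount_of_chord
      (sumCongr_involutive hφ (copies_involutive n (flip_involutive _)))
      (Sum.inl_injective.comp (injective_triple ht 0))
      (fun j => by
        obtain ⟨d, hd⟩ := hr 0 j
        exact ⟨.inl d, congrArg Sum.inl hd⟩) hN₁
    exact ⟨N₂, by rwa [faceCounts_scaffoldsBase_succ], by omega⟩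

end Equiv.Perm

end

/-! ### From `Graph` to darts: face counts, components and existence of the genus -/

section

open Equiv.Perm

namespace Graph

theorem RotationSystem.isRotation {α β : Type*} {G : Graph α β} (R : G.RotationSystem) :
    IsRotation R.base R.rot := R.sameCycle_rot_iff

/-- The face counts of the rotation systems of a graph do not depend on the orientation of its
edges. -/
theorem faceCounts_eq_of_isLink {α β E₀ : Type*} {G : Graph α β} (e : G.edgeSet ≃ E₀)
    {b : E₀ × Bool → α} (hb : ∀ x : G.edgeSet, G.IsLink x (b (e x, false)) (b (e x, true)))
    {b' : G.edgeSet × Bool → α} (hb' : ∀ x : G.edgeSet, G.IsLink x (b' (x, false)) (b' (x, true))) :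
    faceCounts (flipEnds G.edgeSet) b' = faceCounts (flip E₀) b := by
  classical
  -- `ε` records the edges that the two choices of base points orient oppositely; reversing these
  -- commutes with exchanging ends.
  have hex : ∀ x : G.edgeSet, ∃ ε : Bool, ∀ s, b' (x, s) = b (e x, xor s ε) := by
    intro x
    rcases (hb' x).eq_and_eq_or_eq_and_eq (hb x) with ⟨h1, h2⟩ | ⟨h1, h2⟩
    · exact ⟨false, by rintro (_ | _) <;> simp [h1, h2]⟩
    · exact ⟨true, by rintro (_ | _) <;> simp [h1, h2]⟩
  choose ε hε using hex
  let ψ : G.edgeSet × Bool ≃ E₀ × Bool :=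
    { toFun := fun d => (e d.1, xor d.2 (ε d.1))
      invFun := fun d => (e.symm d.1, xor d.2 (ε (e.symm d.1)))
      left_inv := fun d => by simp
      right_inv := fun d => by simp }
  refine faceCounts_congr_of_injective ψ Function.injective_id (fun d => ?_) fun d => (hε _ _).symm
  change (e d.1, xor (!d.2) (ε d.1)) = (e d.1, !(xor d.2 (ε d.1)))
  simp

theorem RotationSystem.numCycles_mem_faceCounts {α β E₀ : Type*} {G : Graph α β}
    (R : G.RotationSystem) (e : G.edgeSet ≃ E₀) {b : E₀ × Bool → α}
    (hb : ∀ x : G.edgeSet, G.IsLink x (b (e x, false)) (b (e x, true))) :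
    R.faceTrace.numCycles ∈ faceCounts (flip E₀) b := by
  rw [← faceCounts_eq_of_isLink e hb R.isLink_base]
  exact ⟨R.rot, R.isRotation, rfl⟩

theorem exists_rotationSystem {α β E₀ : Type*} {G : Graph α β} (e : G.edgeSet ≃ E₀)
    {b : E₀ × Bool → α} (hb : ∀ x : G.edgeSet, G.IsLink x (b (e x, false)) (b (e x, true))) {N : ℕ}
    (hN : N ∈ faceCounts (flip E₀) b) : ∃ R : G.RotationSystem, R.faceTrace.numCycles = N := by
  rw [← faceCounts_eq_of_isLink e hb (b' := fun d => b (e d.1, d.2)) hb] at hN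
  obtain ⟨ρ, hρ, rfl⟩ := hN
  exact ⟨⟨_, hb, ρ, hρ⟩, rfl⟩

theorem exists_base {α β : Type*} (G : Graph α β) :
    ∃ b : G.edgeSet × Bool → α, ∀ x : G.edgeSet, G.IsLink x (b (x, false)) (b (x, true)) := by
  have h : ∀ x : G.edgeSet, ∃ p : α × α, G.IsLink x p.1 p.2 := fun x => by
    obtain ⟨u, v, h⟩ := G.exists_isLink_of_mem_edgeSet x.2
    exact ⟨(u, v), h⟩
  choose p hp using h
  exact ⟨fun d => cond d.2 (p d.1).2 (p d.1).1, hp⟩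

theorem reachable_comm {α β : Type*} {G : Graph α β} {x y : α} (h : G.Reachable x y) :
    G.Reachable y x := by
  induction h with
  | refl => exact Relation.ReflTransGen.refl
  | tail _ h ih => exact Relation.ReflTransGen.head h.symm ih

theorem numComponents_eq_card {α β : Type*} (G : Graph α β) {b : G.edgeSet × Bool → G.vertexSet}
    (hb : ∀ x : G.edgeSet, G.IsLink x (b (x, false)) (b (x, true))) :
    G.numComponents = Nat.card (Quotient (connSetoid b Set.univ)) := by
  have hle : ∀ x y : G.vertexSet, connSetoid b Set.univ x y ↔ G.Reachable x y := by
    intro x y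
    constructor
    · let r : Setoid G.vertexSet := ⟨fun x y => G.Reachable x y, fun _ => Relation.ReflTransGen.refl,
        reachable_comm, Relation.ReflTransGen.trans⟩
      have : connSetoid b Set.univ ≤ r :=
        connSetoid_le_iff.2 fun e _ => Relation.ReflTransGen.single (hb e).adj
      exact fun h => this h
    · intro h
      obtain ⟨y, hy⟩ := y
      change G.Reachable x y at h
      induction h with
      | refl => exact (connSetoid b Set.univ).refl _
      | tail h1 h2 ih =>
        obtain ⟨e, he⟩ := h2
        refine (connSetoid b Set.univ).trans (ih he.left_mem) ?_
        have h3 := hb ⟨e, he.edge_mem⟩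
        rcases he.eq_and_eq_or_eq_and_eq h3 with ⟨h4, h5⟩ | ⟨h4, h5⟩
        · have := connSetoid_base (b := b) (Set.mem_univ ⟨e, he.edge_mem⟩) false true
          convert this using 1 <;> exact Subtype.ext (by assumption)
        · have := connSetoid_base (b := b) (Set.mem_univ ⟨e, he.edge_mem⟩) true false
          convert this using 1 <;> exact Subtype.ext (by assumption)
  rw [numComponents, ← Nat.card_coe_set_eq]
  refine Nat.card_congr (Equiv.ofBijective (fun q => Quotient.lift (fun x : G.vertexSet =>
    (⟨{y | G.Reachable x y}, x, x.2, rfl⟩ :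
      {C : Set α | ∃ x ∈ G.vertexSet, C = {y | G.Reachable x y}})) ?_ q) ⟨?_, ?_⟩).symm
  · intro x y h
    have h' := (hle x y).1 h
    refine Subtype.ext (Set.ext fun z => ?_)
    exact ⟨fun hz => (reachable_comm h').trans hz, fun hz => h'.trans hz⟩
  · intro p q
    refine Quotient.inductionOn₂ p q fun x y h => Quotient.sound ((hle x y).2 ?_)
    have h1 : {z | G.Reachable x z} = {z | G.Reachable y z} := congrArg Subtype.val h
    have h2 : (y : α) ∈ {z | G.Reachable x z} := h1 ▸ Relation.ReflTransGen.refl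
    exact h2
  · rintro ⟨_, x, hx, rfl⟩
    exact ⟨Quotient.mk _ ⟨x, hx⟩, rfl⟩

/-- The genus of a rotation system of a finite graph exists. -/
theorem RotationSystem.exists_hasGenus {α β : Type*} {G : Graph α β} (hV : G.vertexSet.Finite)
    (hE : G.edgeSet.Finite) (R : G.RotationSystem) : ∃ k, R.HasGenus k := by
  have := hV.to_subtype
  have := hE.to_subtype
  have hmem : ∀ d, R.base d ∈ G.vertexSet := by
    rintro ⟨e, _ | _⟩
    · exact (R.isLink_base e).left_mem
    · exact (R.isLink_base e).right_mem
  let b : G.edgeSet × Bool → G.vertexSet := fun d => ⟨R.base d, hmem d⟩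
  have hR : IsRotation b R.rot := fun d d' => by rw [R.isRotation]; simp [b]
  obtain ⟨k, hk⟩ := hR.exists_genus
  refine ⟨k, ?_⟩
  rw [HasGenus, numFaces, numComponents_eq_card G (b := b) R.isLink_base]
  have hiso : {v ∈ G.vertexSet | ∀ e, ¬ G.Inc e v}.ncard = Nat.card {v // v ∉ Set.range b} := by
    rw [← Nat.card_coe_set_eq]
    have h1 : ∀ v : G.vertexSet, v ∉ Set.range b ↔ ∀ e, ¬ G.Inc e v := by
      intro v
      refine ⟨fun h e he => ?_, fun h => ?_⟩
      · have hl := R.isLink_base ⟨e, he.edge_mem⟩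
        rcases he.eq_or_eq_of_isLink hl with h' | h' <;> exact h ⟨_, Subtype.ext h'.symm⟩
      · rintro ⟨⟨e, _ | _⟩, rfl⟩
        · exact h e (R.isLink_base e).inc_left
        · exact h e (R.isLink_base e).inc_right
    exact Nat.card_congr ((Equiv.subtypeSubtypeEquivSubtypeInter (· ∈ G.vertexSet)
      fun v => ∀ e, ¬ G.Inc e v).symm.trans (Equiv.subtypeEquivRight fun v => (h1 v).symm))
  rw [hiso]
  rw [Nat.card_coe_set_eq, Nat.card_coe_set_eq] at hk
  exact hk

theorem genus_le {α β : Type*} {G : Graph α β} {R : G.RotationSystem} {k : ℕ} (h : R.HasGenus k) :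
    G.genus ≤ k := Nat.sInf_le ⟨R, h⟩

/-- Some rotation system exists and has a genus, so the infimum is over a nonempty set and is
attained, rather than being the default value 0. -/
theorem exists_hasGenus_genus {α β : Type*} {G : Graph α β} (hV : G.vertexSet.Finite)
    (hE : G.edgeSet.Finite) : ∃ R : G.RotationSystem, R.HasGenus G.genus := by
  have := hE.to_subtype
  obtain ⟨b, hb⟩ := G.exists_base
  obtain ⟨N, hN⟩ := faceCounts_nonempty (flip G.edgeSet) b
  obtain ⟨R, -⟩ := exists_rotationSystem (Equiv.refl _) hb hN
  obtain ⟨k, hk⟩ := R.exists_hasGenus hV hE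
  exact Nat.sInf_mem (s := {k | ∃ R : G.RotationSystem, R.HasGenus k}) ⟨k, R, hk⟩

end Graph

end

/-! ### Vertices, edges and components of the chorded and scaffolded graphs -/

section

open Equiv.Perm

namespace Graph

section addEdges

variable {α β γ : Type*} {G : Graph α β} {p : γ → Sym2 α}

theorem inl_mem_edgeSet_addEdges {e : β} : .inl e ∈ (G.addEdges p).edgeSet ↔ e ∈ G.edgeSet := by
  rw [edge_mem_iff_exists_isLink, edge_mem_iff_exists_isLink]; rfl

theorem inr_mem_edgeSet_addEdges {c : γ} : .inr c ∈ (G.addEdges p).edgeSet := by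
  rw [edge_mem_iff_exists_isLink]
  induction h : p c using Sym2.ind with | _ x y
  exact ⟨x, y, h⟩

/-- The edges of `G.addEdges p`. -/
def edgeSetAddEdges (G : Graph α β) (p : γ → Sym2 α) :
    (G.addEdges p).edgeSet ≃ G.edgeSet ⊕ γ where
  toFun
    | ⟨.inl e, h⟩ => .inl ⟨e, inl_mem_edgeSet_addEdges.1 h⟩
    | ⟨.inr c, _⟩ => .inr c
  invFun := Sum.elim (fun e => ⟨.inl e, inl_mem_edgeSet_addEdges.2 e.2⟩)
    fun c => ⟨.inr c, inr_mem_edgeSet_addEdges⟩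
  left_inv := by rintro ⟨e | c, h⟩ <;> rfl
  right_inv := by rintro (e | c) <;> rfl

theorem finite_edgeSet_addEdges [Finite γ] (h : G.edgeSet.Finite) :
    (G.addEdges p).edgeSet.Finite :=
  have := h.to_subtype
  Set.finite_coe_iff.1 (Finite.of_equiv _ (edgeSetAddEdges G p).symm)

theorem ncard_edgeSet_addEdges [Finite γ] (h : G.edgeSet.Finite) :
    (G.addEdges p).edgeSet.ncard = G.edgeSet.ncard + Nat.card γ := by
  have := h.to_subtype
  rw [← Nat.card_coe_set_eq, Nat.card_congr (edgeSetAddEdges G p), Nat.card_sum,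
    Nat.card_coe_set_eq]

theorem Reachable.addEdges {x y : α} (h : G.Reachable x y) : (G.addEdges p).Reachable x y := by
  induction h with
  | refl => exact Relation.ReflTransGen.refl
  | tail _ h ih => exact ih.tail (h.imp' .inl fun _ he => he)

end addEdges

section chords

variable {α β : Type*} {G : Graph α β} {n : ℕ} {t : Fin n → Fin 3 → α} {c : Fin n → Fin 3}

theorem addChords_isLink_inr (i : Fin n) :
    (G.addChords t c).IsLink (.inr i) (t i (c i + 1)) (t i (c i + 2)) := rfl

theorem vertexSet_addChords (ht : ∀ i j, t i j ∈ G.vertexSet) :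
    (G.addChords t c).vertexSet = G.vertexSet := by
  refine Set.union_eq_self_of_subset_right ?_
  rintro x ⟨i, hi⟩
  rcases Sym2.mem_iff.1 hi with rfl | rfl <;> exact ht _ _

theorem reachable_addChords_iff (hconn : ∀ i j k, G.Reachable (t i j) (t i k)) {x y : α} :
    (G.addChords t c).Reachable x y ↔ G.Reachable x y := by
  refine ⟨fun h => ?_, Reachable.addEdges⟩
  induction h with
  | refl => exact Relation.ReflTransGen.refl
  | tail _ h ih =>
    refine ih.trans ?_
    obtain ⟨e | i, h⟩ := h
    · exact Relation.ReflTransGen.single ⟨e, h⟩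
    · rcases h.eq_and_eq_or_eq_and_eq (addChords_isLink_inr i) with ⟨rfl, rfl⟩ | ⟨rfl, rfl⟩ <;>
        exact hconn _ _ _

theorem numComponents_addChords (ht : ∀ i j, t i j ∈ G.vertexSet)
    (hconn : ∀ i j k, G.Reachable (t i j) (t i k)) :
    (G.addChords t c).numComponents = G.numComponents := by
  simp only [numComponents, vertexSet_addChords ht, reachable_addChords_iff hconn]

theorem isolated_addChords (ht : ∀ i j, ∃ e, G.Inc e (t i j)) :
    {v ∈ (G.addChords t c).vertexSet | ∀ e, ¬ (G.addChords t c).Inc e v} =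
      {v ∈ G.vertexSet | ∀ e, ¬ G.Inc e v} := by
  rw [vertexSet_addChords fun i j => (ht i j).choose_spec.vertex_mem]
  ext v
  refine and_congr_right fun _ => ⟨fun h e => h (.inl e), ?_⟩
  rintro h (e | i) hi
  · exact h e hi
  · rcases hi.eq_or_eq_of_isLink (addChords_isLink_inr i) with rfl | rfl
    all_goals
      obtain ⟨e, he⟩ := ht _ _
      exact h e he

end chords

section scaffold

variable {α β : Type*} {G : Graph α β} {n : ℕ} {t : Fin n → Fin 3 → α}

theorem scaffold_isLink_inl {e : β} {x y : α} (h : G.IsLink e x y) :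
    (G.scaffold t).IsLink (.inl e) (.inl x) (.inl y) := ⟨x, y, h, rfl, rfl⟩

theorem scaffold_isLink_inr (i : Fin n) (k : H3Edge) :
    (G.scaffold t).IsLink (.inr (i, k)) (Sum.map (t i) (Prod.mk i) (H3Edge.base (k, false)))
      (Sum.map (t i) (Prod.mk i) (H3Edge.base (k, true))) := by
  cases k <;> rfl

theorem vertexSet_scaffold (ht : ∀ i j, t i j ∈ G.vertexSet) :
    (G.scaffold t).vertexSet = Sum.inl '' G.vertexSet ∪ Sum.inr '' Set.univ := by
  refine Set.Subset.antisymm ?_ ?_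
  · rintro (x | q) h
    · rcases h with h | ⟨⟨i, k⟩, hk⟩
      · exact Or.inl h
      · left
        cases k with
        | free j =>
          rcases Sym2.mem_iff.1 hk with h | h
          · exact ⟨_, ht i j, h.symm⟩
          · cases h
        | core j b => rcases Sym2.mem_iff.1 hk with h | h <;> cases h
    · exact Or.inr ⟨q, trivial, rfl⟩
  · rintro _ (⟨x, hx, rfl⟩ | ⟨⟨i, v⟩, -, rfl⟩)
    · exact Or.inl ⟨x, hx, rfl⟩
    · cases v with
      | mid j => exact (scaffold_isLink_inr i (.core j false)).left_mem
      | hub b => exact (scaffold_isLink_inr i (.core 0 b)).right_mem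

theorem ncard_vertexSet_scaffold (hV : G.vertexSet.Finite) (ht : ∀ i j, t i j ∈ G.vertexSet) :
    (G.scaffold t).vertexSet.ncard = G.vertexSet.ncard + 5 * n := by
  rw [vertexSet_scaffold ht, Set.ncard_union_eq ?_ (hV.image _) (Set.toFinite _),
    Set.ncard_image_of_injective _ Sum.inl_injective,
    Set.ncard_image_of_injective _ Sum.inr_injective, Set.ncard_univ, Nat.card_prod,
    Nat.card_eq_fintype_card (α := H3Inner), Nat.card_eq_fintype_card, Fintype.card_fin, mul_comm n]
  · rfl
  · rw [Set.disjoint_left]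
    rintro _ ⟨x, -, rfl⟩ ⟨y, -, h⟩
    cases h

theorem finite_vertexSet_scaffold (hV : G.vertexSet.Finite) (ht : ∀ i j, t i j ∈ G.vertexSet) :
    (G.scaffold t).vertexSet.Finite := by
  rw [vertexSet_scaffold ht]
  exact (hV.image _).union (Set.toFinite _)

theorem isolated_scaffold (ht : ∀ i j, ∃ e, G.Inc e (t i j)) :
    {v ∈ (G.scaffold t).vertexSet | ∀ e, ¬ (G.scaffold t).Inc e v} =
      Sum.inl '' {v ∈ G.vertexSet | ∀ e, ¬ G.Inc e v} := by
  rw [vertexSet_scaffold fun i j => (ht i j).choose_spec.vertex_mem]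
  ext v
  constructor
  · rintro ⟨⟨x, hx, rfl⟩ | ⟨⟨i, v⟩, -, rfl⟩, h⟩
    · exact ⟨x, ⟨hx, fun e ⟨y, he⟩ => h _ ⟨_, scaffold_isLink_inl he⟩⟩, rfl⟩
    · cases v with
      | mid j => exact absurd (scaffold_isLink_inr i (.core j false)).inc_left (h _)
      | hub b => exact absurd (scaffold_isLink_inr i (.core 0 b)).inc_right (h _)
  · rintro ⟨x, ⟨hx, h⟩, rfl⟩
    refine ⟨Or.inl ⟨x, hx, rfl⟩, ?_⟩
    rintro (e | ⟨i, k⟩) hk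
    · obtain ⟨_, x', y, h', hx', -⟩ := hk
      cases Sum.inl_injective hx'
      exact h e ⟨y, h'⟩
    · cases k with
      | free j =>
        rcases hk.eq_or_eq_of_isLink (scaffold_isLink_inr i _) with h' | h'
        · cases Sum.inl_injective h'
          obtain ⟨e, he⟩ := ht i j
          exact h e he
        · cases h'
      | core j b => rcases hk.eq_or_eq_of_isLink (scaffold_isLink_inr i _) with h' | h' <;> cases h'

/-- The retraction of the vertices of the scaffolded graph. -/
def scaffoldProj (t : Fin n → Fin 3 → α) : α ⊕ Fin n × H3Inner → α :=
  Sum.elim id fun p => t p.1 0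

theorem scaffold_reachable_proj (a : α ⊕ Fin n × H3Inner) :
    (G.scaffold t).Reachable (.inl (scaffoldProj t a)) a := by
  have hadj : ∀ i k, (G.scaffold t).Reachable
      (Sum.map (t i) (Prod.mk i) (H3Edge.base (k, false)))
      (Sum.map (t i) (Prod.mk i) (H3Edge.base (k, true))) := fun i k =>
    Relation.ReflTransGen.single (scaffold_isLink_inr i k).adj
  have hhub : ∀ i b, (G.scaffold t).Reachable (.inl (t i 0)) (.inr (i, .hub b)) := fun i b =>
    (hadj i (.free 0)).trans (hadj i (.core 0 b))
  rcases a with x | ⟨i, j | b⟩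
  · exact Relation.ReflTransGen.refl
  · exact (hhub i false).trans (reachable_comm (hadj i (.core j false)))
  · exact hhub i b

/-- Collapsing the inner vertices of each copy of `H₃` to `t i 0` keeps walks connected, because
each triple lies in one component of `G`. -/
theorem reachable_scaffold_iff (hconn : ∀ i j k, G.Reachable (t i j) (t i k))
    {a b : α ⊕ Fin n × H3Inner} :
    (G.scaffold t).Reachable a b ↔ G.Reachable (scaffoldProj t a) (scaffoldProj t b) := by
  constructor
  · intro h
    induction h with
    | refl => exact Relation.ReflTransGen.refl
    | tail _ h ih =>
      refine ih.trans ?_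
      obtain ⟨e | ⟨i, k⟩, h⟩ := h
      · obtain ⟨x, y, hxy, rfl, rfl⟩ := h
        exact Relation.ReflTransGen.single ⟨e, hxy⟩
      · rcases h.eq_and_eq_or_eq_and_eq (scaffold_isLink_inr i k) with ⟨rfl, rfl⟩ | ⟨rfl, rfl⟩ <;>
          cases k <;> exact hconn _ _ _
  · intro h
    have hlift : ∀ x y, G.Reachable x y → (G.scaffold t).Reachable (.inl x) (.inl y) := by
      intro x y h
      induction h with
      | refl => exact Relation.ReflTransGen.refl
      | tail _ h ih => exact ih.tail (h.imp' .inl fun _ he => scaffold_isLink_inl he)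
    exact ((reachable_comm (scaffold_reachable_proj a)).trans (hlift _ _ h)).trans
      (scaffold_reachable_proj b)

theorem numComponents_scaffold (ht : ∀ i j, t i j ∈ G.vertexSet)
    (hconn : ∀ i j k, G.Reachable (t i j) (t i k)) :
    (G.scaffold t).numComponents = G.numComponents := by
  have hsurj : Function.Surjective (scaffoldProj t) := fun x => ⟨.inl x, rfl⟩
  rw [numComponents, numComponents,
    ← Set.ncard_image_of_injective {C | ∃ x ∈ G.vertexSet, C = {y | G.Reachable x y}}
      hsurj.preimage_injective]
  congr 1
  ext C
  simp only [reachable_scaffold_iff hconn, vertexSet_scaffold ht]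
  constructor
  · rintro ⟨a, ha, rfl⟩
    refine ⟨_, ⟨scaffoldProj t a, ?_, rfl⟩, rfl⟩
    rcases ha with ⟨x, hx, rfl⟩ | ⟨p, -, rfl⟩
    · exact hx
    · exact ht _ _
  · rintro ⟨_, ⟨x, hx, rfl⟩, rfl⟩
    exact ⟨.inl x, Or.inl ⟨x, hx, rfl⟩, rfl⟩

end scaffold

section faces

variable {α β : Type*} {G : Graph α β} {n : ℕ} {t : Fin n → Fin 3 → α}
  {b : G.edgeSet × Bool → α}

/-- The edges of `G.addChords t c`. -/
def edgeSetAddChords (G : Graph α β) (t : Fin n → Fin 3 → α) (c : Fin n → Fin 3) :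
    (G.addChords t c).edgeSet ≃ G.edgeSet ⊕ Fin n := edgeSetAddEdges G _

/-- The edges of `G.scaffold t`. -/
def edgeSetScaffold (G : Graph α β) (t : Fin n → Fin 3 → α) :
    (G.scaffold t).edgeSet ≃ G.edgeSet ⊕ Fin n × H3Edge := edgeSetAddEdges (G.map Sum.inl) _

/-- The darts of the graph with `n` added edges. -/
def chordDarts (E : Type*) (n : ℕ) : (E ⊕ Fin n) × Bool ≃ E × Bool ⊕ Fin n × Bool :=
  Equiv.sumProdDistrib E (Fin n) Bool

/-- The darts of the graph with `n` added copies of `H₃`. -/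
def scaffoldDarts (E : Type*) (n : ℕ) :
    (E ⊕ Fin n × H3Edge) × Bool ≃ E × Bool ⊕ Fin n × (H3Edge × Bool) :=
  (Equiv.sumProdDistrib E (Fin n × H3Edge) Bool).trans
    (Equiv.sumCongr (Equiv.refl _) (Equiv.prodAssoc _ _ _))

theorem faceCounts_chordsBase_comp (E : Type*) (b : E × Bool → α) (c : Fin n → Fin 3) :
    faceCounts (flip (E ⊕ Fin n)) (chordsBase b t c ∘ chordDarts E n) =
      faceCounts (Equiv.Perm.sumCongr (flip E) (copies n Equiv.boolNot)) (chordsBase b t c) := by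
  refine faceCounts_congr_of_injective (chordDarts E n) Function.injective_id ?_ fun d => rfl
  rintro ⟨e | e, s⟩ <;> rfl

theorem faceCounts_scaffoldsBase_comp (E : Type*) (b : E × Bool → α) :
    faceCounts (flip (E ⊕ Fin n × H3Edge)) (scaffoldsBase b t ∘ scaffoldDarts E n) =
      faceCounts (Equiv.Perm.sumCongr (flip E) (copies n (flip H3Edge))) (scaffoldsBase b t) := by
  refine faceCounts_congr_of_injective (scaffoldDarts E n) Function.injective_id ?_ fun d => rfl
  rintro ⟨e | e, s⟩ <;> rfl

theorem isLink_chordsBase (hb : ∀ x : G.edgeSet, G.IsLink x (b (x, false)) (b (x, true)))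
    (c : Fin n → Fin 3) (x : (G.addChords t c).edgeSet) :
    (G.addChords t c).IsLink x
      ((chordsBase b t c ∘ chordDarts _ n) (edgeSetAddChords G t c x, false))
      ((chordsBase b t c ∘ chordDarts _ n) (edgeSetAddChords G t c x, true)) := by
  rcases x with ⟨e | i, h⟩
  · exact hb ⟨e, _⟩
  · exact addChords_isLink_inr i

theorem isLink_scaffoldsBase (hb : ∀ x : G.edgeSet, G.IsLink x (b (x, false)) (b (x, true)))
    (x : (G.scaffold t).edgeSet) :
    (G.scaffold t).IsLink x
      ((scaffoldsBase b t ∘ scaffoldDarts _ n) (edgeSetScaffold G t x, false))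
      ((scaffoldsBase b t ∘ scaffoldDarts _ n) (edgeSetScaffold G t x, true)) := by
  rcases x with ⟨e | ⟨i, k⟩, h⟩
  · exact scaffold_isLink_inl (hb ⟨e, _⟩)
  · exact scaffold_isLink_inr i k

end faces

end Graph

end

/-! ### Comparison of the genera -/

open Graph Equiv.Perm in
theorem mainTheorem3 {α β : Type*} (G : Graph α β)
    (hV : G.vertexSet.Finite) (hE : G.edgeSet.Finite)
    (n : ℕ) (t : Fin n → Fin 3 → α)
    (ht : Function.Injective fun q : Fin n × Fin 3 => t q.1 q.2)
    (hval : ∀ i j, G.valence (t i j) = 2)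
    (hconn : ∀ i j k, G.Reachable (t i j) (t i k)) :
    (G.scaffold t).genus = G.chordGenus t + n := by
  -- Positive valence supplies a dart of `G` at each vertex of a triple, as attaching and detaching
  -- require, and keeps the set of isolated vertices unchanged.
  have hinc : ∀ i j, ∃ e, G.Inc e (t i j) := by
    intro i j
    by_contra! h
    have h1 : G.incidenceSet (t i j) = ∅ := Set.eq_empty_of_forall_notMem h
    have h2 : G.loopSet (t i j) = ∅ :=
      Set.eq_empty_of_forall_notMem fun e he => h e ⟨_, he⟩
    have h3 := hval i j
    rw [valence, h1, h2] at h3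
    simp at h3
  have hmem : ∀ i j, t i j ∈ G.vertexSet := fun i j => (hinc i j).choose_spec.vertex_mem
  have := hE.to_subtype
  obtain ⟨b, hb⟩ := G.exists_base
  have hr : ∀ i j, t i j ∈ Set.range b := by
    intro i j
    obtain ⟨e, he⟩ := hinc i j
    rcases he.eq_or_eq_of_isLink (hb ⟨e, he.edge_mem⟩) with h | h <;> exact ⟨_, h.symm⟩
  have hflip := flip_involutive G.edgeSet
  have hXV : ∀ c, (G.addChords t c).vertexSet.Finite := fun c => by rwa [vertexSet_addChords hmem]
  have hXE : ∀ c, (G.addChords t c).edgeSet.Finite := fun c => finite_edgeSet_addEdges hE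
  have hHV := finite_vertexSet_scaffold hV hmem
  have hHE : (G.scaffold t).edgeSet.Finite := finite_edgeSet_addEdges (G := G.map Sum.inl) hE
  have hXgenus : ∀ c (R : (G.addChords t c).RotationSystem) k, R.HasGenus k ↔
      G.vertexSet.ncard + (R.faceTrace.numCycles + {v ∈ G.vertexSet | ∀ e, ¬ G.Inc e v}.ncard) +
        2 * k = G.edgeSet.ncard + n + 2 * G.numComponents := by
    intro c R k
    have h1 : (G.addChords t c).edgeSet.ncard = G.edgeSet.ncard + n := by
      rw [addChords, ncard_edgeSet_addEdges hE, Nat.card_eq_fintype_card, Fintype.card_fin]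
    rw [RotationSystem.HasGenus, RotationSystem.numFaces, isolated_addChords hinc,
      vertexSet_addChords hmem, numComponents_addChords hmem hconn, h1]
    rfl
  have hHgenus : ∀ (R : (G.scaffold t).RotationSystem) k, R.HasGenus k ↔
      G.vertexSet.ncard + 5 * n + (R.faceTrace.numCycles +
        {v ∈ G.vertexSet | ∀ e, ¬ G.Inc e v}.ncard) + 2 * k =
          G.edgeSet.ncard + 9 * n + 2 * G.numComponents := by
    intro R k
    have h1 : (G.scaffold t).edgeSet.ncard = G.edgeSet.ncard + 9 * n := by
      rw [scaffold, ncard_edgeSet_addEdges (G := G.map Sum.inl) hE, Nat.card_prod,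
        Nat.card_eq_fintype_card (α := H3Edge), Nat.card_eq_fintype_card, Fintype.card_fin,
        mul_comm n]
      rfl
    rw [RotationSystem.HasGenus, RotationSystem.numFaces, isolated_scaffold hinc,
      ncard_vertexSet_scaffold hV hmem, numComponents_scaffold hmem hconn, h1,
      Set.ncard_image_of_injective _ Sum.inl_injective]
    rfl
  -- In both directions one takes a rotation system of minimum genus on one side and transfers its
  -- face count to the other; the two Euler formulas above then give the inequality.
  apply le_antisymm
  · obtain ⟨c, hc⟩ := exists_eq_ciInf_of_finite (f := fun c => (G.addChords t c).genus)
    obtain ⟨R, hR⟩ := exists_hasGenus_genus (hXV c) (hXE c)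
    have h1 := R.numCycles_mem_faceCounts (edgeSetAddChords G t c) (isLink_chordsBase hb c)
    rw [faceCounts_chordsBase_comp] at h1
    obtain ⟨N, hN, hle⟩ := exists_scaffolds_faceCount_of_chords hflip ht hr h1
    rw [← faceCounts_scaffoldsBase_comp] at hN
    obtain ⟨R', rfl⟩ := exists_rotationSystem (edgeSetScaffold G t)
      (isLink_scaffoldsBase hb) hN
    obtain ⟨k, hk⟩ := R'.exists_hasGenus hHV hHE
    refine (genus_le hk).trans ?_
    rw [hXgenus] at hR
    rw [hHgenus] at hk
    rw [chordGenus, ← hc]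
    omega
  · obtain ⟨R, hR⟩ := exists_hasGenus_genus hHV hHE
    have h1 := R.numCycles_mem_faceCounts (edgeSetScaffold G t)
      (isLink_scaffoldsBase hb)
    rw [faceCounts_scaffoldsBase_comp] at h1
    obtain ⟨c, N, hN, hle⟩ := exists_chords_faceCount_of_scaffolds hflip ht hr h1
    rw [← faceCounts_chordsBase_comp] at hN
    obtain ⟨R', rfl⟩ := exists_rotationSystem (edgeSetAddChords G t c) (isLink_chordsBase hb c) hN
    obtain ⟨k, hk⟩ := R'.exists_hasGenus (hXV c) (hXE c)
    have h2 : G.chordGenus t ≤ k := (ciInf_le (OrderBot.bddBelow _) c).trans (genus_le hk)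
    rw [hXgenus] at hk
    rw [hHgenus] at hR
    omega
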